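/- **Theorem.** Let $W=(W(t))_{t\in\mathbb R}$ be a standard two-sided Brownian motion on a probability space (that is, $(W(t))_{t\ge0}$ and $(W(-t))_{t\ge 0}$ are independent standard Brownian motions with almost surely continuous paths). For $T\in\mathbb R$ consider, for $t\ge -T$, the infinite linear system $$da_n(t)=\big[(n-1)a_{n-1}(t)-n\,a_{n+1}(t)\big]dt+\mathbf 1_{n=1}\,dW(t),\qquad n\ge 1,\qquad a_0\equiv 0,$$ with initial condition $a_n(-T)=\alpha_n$, where the real sequence $\alpha=(\alpha_n)_{n\ge1}$ does not depend on $T$. *Initial data.* $\alpha$ is called admissible if $G_0(z)=\sum_{n\ge0}\alpha_{n+1}z^n$ converges near $z=0$ and extends analytically to a neighbourhood of $(-1,0]$, the limit of $G_0(x)$ as $x\to-1^+$ along the real axis exists and is finite, and for some $\delta,\theta>0$ the function $G_0$ is analytic and bounded in the sector $\{z:0<|z+1|<\delta,\ |\arg(z+1)|<\theta\}$. *Solutions.* A solution is a family of functions $a_n(t)$, continuous in $t\ge -T$, that satisfies the system path by path in integrated form and has a generating function in the following sense: for every $t_1\ge -T$ there are $C,K$ with $|a_n(t)|\le CK^n$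 for all $n$ and all $t\in[-T,t_1]$ (so $\sum_{n\ge0} a_{n+1}(t)z^n$ converges on a disc around $0$ that is fixed on bounded time intervals). Then: 1. Almost surely, for every $T$ and every admissible $\alpha$, there is exactly one solution $a^{(T)}$ on $[-T,\infty)$ with $a^{(T)}_n(-T)=\alpha_n$ for all $n\ge 1$. 2. There are random variables $a_n^{**}(t)$, $n\ge1$, $t\in\mathbb R$, which are versions of the stochastic integrals $$a_n^{**}(t)=\int_{-\infty}^t\frac{\tanh^{n-1}(t-s)}{\cosh(t-s)}\,dW(s)$$ ($L^2$ limits of the elementary integrals of step functions converging in $L^2(\mathbb R)$ to the integrand), such that for every $n\ge 1$ and $t\in\mathbb R$, almost surely, for every admissible $\alpha$, $$\lim_{T\to\infty}a^{(T)}_n(t)=a_n^{**}(t).$$ 3. The process $(a_n^{**}(t))_{n\ge1,\,t\in\mathbb R}$ is jointly Gaussian with mean zero and stationary in time (for every $h$, the finite-dimensional distributions of $(a_n^{**}(t+h))_{n,t}$ and $(a_n^{**}(t))_{n,t}$ agree), and $$\mathbb E\,a_n^{**}(t)\,a_m^{**}(t)=\frac1{n+m-1}\qquad\text{for all } n,m\ge1,\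 t\in\mathbb R.$$ -/

import Mathlib

open MeasureTheory ProbabilityTheory Filter Topology
open scoped NNReal ENNReal

namespace ShellModel

/-- A standard two-sided Brownian motion: `(W t)` and `(W (-t))`, `t ≥ 0`, are two independent
standard Brownian motions (with almost surely continuous paths, started at `0`). -/
structure IsTwoSidedBrownian {Ω : Type*} [MeasurableSpace Ω] (W : ℝ → Ω → ℝ) (P : Measure Ω) :
    Prop where
  forward : IsBrownianReal (fun (t : ℝ≥0) ω => W (t : ℝ) ω) P
  backward : IsBrownianReal (fun (t : ℝ≥0) ω => W (-(t : ℝ)) ω) P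
  indep : IndepFun (fun ω (t : ℝ≥0) => W (t : ℝ) ω) (fun ω (t : ℝ≥0) => W (-(t : ℝ)) ω) P

/-- The data of a step function `∑ i, c i * 1_{(l i, r i]}` on the real line. -/
structure StepFunction where
  size : ℕ
  c : Fin size → ℝ
  l : Fin size → ℝ
  r : Fin size → ℝ
  l_le_r : ∀ i, l i ≤ r i

/-- The function `∑ i, c i * 1_{(l i, r i]}`. -/
noncomputable def StepFunction.toFun (g : StepFunction) (x : ℝ) : ℝ :=
  ∑ i, (Set.Ioc (g.l i) (g.r i)).indicator (fun _ => g.c i) x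

/-- The elementary stochastic integral `∑ i, c i * (W (r i) - W (l i))` of a step function. -/
noncomputable def StepFunction.integral {Ω : Type*} (g : StepFunction) (W : ℝ → Ω → ℝ) (ω : Ω) :
    ℝ :=
  ∑ i, g.c i * (W (g.r i) ω - W (g.l i) ω)

/-- `I` is (a version of) the stochastic integral `∫ f(s) dW(s)` over the real line of the
deterministic function `f ∈ L²(ℝ)`: the limit in `L²(P)` of the elementary integrals of
step functions that converge to `f` in `L²(ℝ)`. -/
def IsWienerIntegral {Ω : Type*} [MeasurableSpace Ω] (W : ℝ → Ω → ℝ) (P : Measure Ω)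
    (f : ℝ → ℝ) (I : Ω → ℝ) : Prop :=
  MemLp f 2 volume ∧ MemLp I 2 P ∧
    ∃ g : ℕ → StepFunction,
      Tendsto (fun k => eLpNorm (fun x => f x - (g k).toFun x) 2 volume) atTop (𝓝 0) ∧
      Tendsto (fun k => eLpNorm (fun ω => I ω - (g k).integral W ω) 2 P) atTop (𝓝 0)

/-- The function `s ↦ tanh^{n-1}(t-s) / cosh(t-s)` on `(-∞, t]`, extended by zero. -/
noncomputable def kernel (n : ℕ+) (t : ℝ) : ℝ → ℝ :=
  (Set.Iic t).indicator (fun s => Real.tanh (t - s) ^ ((n : ℕ) - 1) / Real.cosh (t - s))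

/-- The admissible initial sequences `α = (α₁, α₂, …)`. The function `G` is the generating function
`∑ α_{k+1} z^k` near `0`, continued analytically to a neighbourhood of `(-1, 0]`; it has a finite
limit at `-1` from the right along the real axis, and it is analytic and bounded in some
(arbitrarily thin and short) sector with vertex `-1` around the real axis. -/
def IsAdmissible (α : ℕ+ → ℝ) : Prop :=
  ∃ G : ℂ → ℂ,
    (∀ᶠ z in 𝓝 (0 : ℂ), HasSum (fun k : ℕ => (α k.succPNat : ℂ) * z ^ k) (G z)) ∧
    (∀ x ∈ Set.Ioc (-1 : ℝ) 0, AnalyticAt ℂ G (x : ℂ)) ∧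
    (∃ L : ℂ, Tendsto (fun x : ℝ => G (x : ℂ)) (𝓝[>] (-1 : ℝ)) (𝓝 L)) ∧
    ∃ δ > (0 : ℝ), ∃ θ > (0 : ℝ), ∃ M : ℝ,
      ∀ z : ℂ, 0 < ‖z + 1‖ → ‖z + 1‖ < δ → |Complex.arg (z + 1)| < θ →
        AnalyticAt ℂ G z ∧ ‖G z‖ ≤ M

/-- `a` solves, on `[t₀, ∞)` and with `a_n(t₀) = α_n`, the system
`da_n = ((n-1) a_{n-1} - n a_{n+1}) dt + 1_{n=1} dw`, `n ≥ 1`, with `a_0 = 0`, driven by the path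
`w`. The noise is additive, so that the equation makes sense, path by path, in integrated form.
The field `growth` says that the generating function `∑ a_{k+1}(t) z^k` of the solution exists,
that is, converges on a disc around `0` that does not shrink on bounded time intervals. -/
structure IsForcedSolution (w : ℝ → ℝ) (t₀ : ℝ) (α : ℕ+ → ℝ) (a : ℕ → ℝ → ℝ) : Prop where
  boundary : ∀ t, t₀ ≤ t → a 0 t = 0
  initial : ∀ n : ℕ+, a n t₀ = α n
  continuous : ∀ n, ContinuousOn (a n) (Set.Ici t₀)
  equation : ∀ n : ℕ, 1 ≤ n → ∀ t, t₀ ≤ t →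
    a n t = a n t₀ + (∫ s in t₀..t, (((n : ℝ) - 1) * a (n - 1) s - (n : ℝ) * a (n + 1) s))
      + (if n = 1 then w t - w t₀ else 0)
  growth : ∀ t₁, t₀ ≤ t₁ → ∃ C K : ℝ, ∀ n, ∀ t ∈ Set.Icc t₀ t₁, |a n t| ≤ C * K ^ n

end ShellModel

/-!
The drift acts on the generating function `G(z) = ∑ a_{k+1} z^k` as the first-order operator
`G ↦ (z² - 1) G' + z G`, so the system without noise transports `G` along the Möbius flow of
`z² - 1`, with a multiplier that decays like `1 / cosh`. This flow carries the points of `(-1, 1)`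
to `-1`, and it carries a small fixed disc around `0` into any given sector with vertex `-1`. If `G`
is bounded in the sector, Cauchy's estimates on that disc show that every coefficient of the
transported function tends to `0`. Uniqueness holds because the homogeneous system, iterated `k`
times on a short interval, bounds a solution of geometric growth by a multiple of `(3/4)^k`.

The response of `a_{m+1}` to a unit impulse in `a_1` is `tanh^m / cosh`, the `m`-th coefficient of
the transport of the constant function `1`. Integration by parts makes the noisy part of the
solution a continuous functional of the path, and this functional converges as the starting time
goes to `-∞` because almost every Brownian path grows at most linearly. The limit is also an almost
sure limit of Riemann sums, hence a Wiener integral. Linear combinations of Wiener integrals are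
centred Gaussian with variance the squared `L²` norm of the integrand, and the substitution
`x = tanh u` turns the covariance into `∫ x^{n+m-2} dx` over `[0, 1]`.
-/

namespace ShellModel

/-! ### Uniqueness -/

/-- The deterministic right-hand side `(n-1) a_{n-1} - n a_{n+1}` of the system. -/
def drift (a : ℕ → ℝ → ℝ) (n : ℕ) (t : ℝ) : ℝ :=
  ((n : ℝ) - 1) * a (n - 1) t - n * a (n + 1) t

lemma drift_add (a b : ℕ → ℝ → ℝ) (n : ℕ) :
    drift (a + b) n = drift a n + drift b n := by
  ext t
  simp only [drift, Pi.add_apply]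
  ring

lemma drift_sub (a b : ℕ → ℝ → ℝ) (n : ℕ) :
    drift (a - b) n = drift a n - drift b n := by
  ext t
  simp only [drift, Pi.sub_apply]
  ring

lemma continuousOn_drift {a : ℕ → ℝ → ℝ} {S : Set ℝ} (ha : ∀ n, ContinuousOn (a n) S) (n : ℕ) :
    ContinuousOn (drift a n) S :=
  (continuousOn_const.mul (ha _)).sub (continuousOn_const.mul (ha _))

lemma abs_drift_succ_le {a : ℕ → ℝ → ℝ} {n : ℕ} {t B : ℝ} (h₁ : |a n t| ≤ B)
    (h₂ : |a (n + 2) t| ≤ B) : |drift a (n + 1) t| ≤ (2 * n + 1) * B := by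
  calc |drift a (n + 1) t| = |n * a n t - (n + 1) * a (n + 2) t| := by
        simp [drift]
    _ ≤ n * |a n t| + (n + 1) * |a (n + 2) t| := by
        refine (abs_sub _ _).trans_eq ?_
        rw [abs_mul, abs_mul, Nat.abs_cast, abs_of_nonneg (by positivity : (0 : ℝ) ≤ n + 1)]
    _ ≤ n * B + (n + 1) * B := by gcongr
    _ = (2 * n + 1) * B := by ring

/-- A solution on `[t₀, t₁]` of the system without noise. The equation is required for all
increments, so that it passes to subintervals. -/
structure IsHomogeneousSolution (t₀ t₁ : ℝ) (a : ℕ → ℝ → ℝ) : Prop where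
  boundary : ∀ t ∈ Set.Icc t₀ t₁, a 0 t = 0
  continuousOn : ∀ n, ContinuousOn (a n) (Set.Icc t₀ t₁)
  equation : ∀ n, 1 ≤ n → ∀ s ∈ Set.Icc t₀ t₁, ∀ t ∈ Set.Icc t₀ t₁,
    a n t - a n s = ∫ x in s..t, drift a n x

namespace IsHomogeneousSolution

variable {t₀ t₁ C K : ℝ} {a : ℕ → ℝ → ℝ}

lemma mono (ha : IsHomogeneousSolution t₀ t₁ a) {s₀ s₁ : ℝ}
    (h : Set.Icc s₀ s₁ ⊆ Set.Icc t₀ t₁) : IsHomogeneousSolution s₀ s₁ a where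
  boundary t ht := ha.boundary t (h ht)
  continuousOn n := (ha.continuousOn n).mono h
  equation n hn s hs t ht := ha.equation n hn s (h hs) t (h ht)

lemma abs_le_mul_pow_succ (ha : IsHomogeneousSolution t₀ t₁ a) {n k : ℕ} {B t : ℝ}
    (h₀ : a (n + 1) t₀ = 0) (ht : t ∈ Set.Icc t₀ t₁)
    (h₁ : ∀ s ∈ Set.Icc t₀ t₁, |a n s| ≤ B * (s - t₀) ^ k)
    (h₂ : ∀ s ∈ Set.Icc t₀ t₁, |a (n + 2) s| ≤ B * (s - t₀) ^ k) :
    |a (n + 1) t| ≤ (2 * n + 1) * B / (k + 1) * (t - t₀) ^ (k + 1) := by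
  have hle : ∀ s ∈ Set.Ioc t₀ t, ‖drift a (n + 1) s‖ ≤ (2 * n + 1) * B * (s - t₀) ^ k := by
    intro s hs
    have hs' : s ∈ Set.Icc t₀ t₁ := ⟨hs.1.le, hs.2.trans ht.2⟩
    rw [mul_assoc]
    exact abs_drift_succ_le (h₁ s hs') (h₂ s hs')
  have hint : ∫ s in t₀..t, (s - t₀) ^ k = (t - t₀) ^ (k + 1) / (k + 1) := by
    rw [intervalIntegral.integral_comp_sub_right (fun x => x ^ k)]
    simp
  have heq := ha.equation (n + 1) (by omega) t₀ ⟨le_rfl, ht.1.trans ht.2⟩ t ht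
  rw [h₀, sub_zero] at heq
  calc |a (n + 1) t| = ‖∫ s in t₀..t, drift a (n + 1) s‖ := by rw [heq, Real.norm_eq_abs]
    _ ≤ ∫ s in t₀..t, (2 * n + 1) * B * (s - t₀) ^ k :=
      intervalIntegral.norm_integral_le_of_norm_le ht.1 (ae_of_all _ hle)
        (Continuous.intervalIntegrable (by fun_prop) _ _)
    _ = (2 * n + 1) * B / (k + 1) * (t - t₀) ^ (k + 1) := by
      rw [intervalIntegral.integral_const_mul, hint]
      ring

lemma abs_le_iterate (ha : IsHomogeneousSolution t₀ t₁ a) (hK : 1 ≤ K) (hC : 0 ≤ C)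
    (h₀ : ∀ n, a n t₀ = 0) (hbd : ∀ n, ∀ t ∈ Set.Icc t₀ t₁, |a n t| ≤ C * K ^ n) (k : ℕ) :
    ∀ n, ∀ t ∈ Set.Icc t₀ t₁,
      |a n t| ≤ C * K ^ (n + k) * ((2 * (n + k)) ^ k / k.factorial) * (t - t₀) ^ k := by
  induction k with
  | zero => simpa using hbd
  | succ k ih =>
    intro n t ht
    have hpos : 0 ≤ t - t₀ := sub_nonneg.2 ht.1
    rcases n with _ | n
    · rw [ha.boundary t ht, abs_zero]
      positivity
    set B : ℝ := C * K ^ (n + 2 + k) * ((2 * (n + 2 + k)) ^ k / k.factorial) with hB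
    have : 0 ≤ B := by positivity
    have hbelow : ∀ s ∈ Set.Icc t₀ t₁, |a n s| ≤ B * (s - t₀) ^ k := fun s hs => by
      refine (ih n s hs).trans ?_
      have := sub_nonneg.2 hs.1
      rw [hB]
      gcongr <;> linarith
    have habove : ∀ s ∈ Set.Icc t₀ t₁, |a (n + 2) s| ≤ B * (s - t₀) ^ k := fun s hs => by
      simpa [hB] using ih (n + 2) s hs
    calc |a (n + 1) t| ≤ (2 * n + 1) * B / (k + 1) * (t - t₀) ^ (k + 1) :=
          ha.abs_le_mul_pow_succ (h₀ _) ht hbelow habove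
      _ ≤ 2 * (n + 2 + k) * B / (k + 1) * (t - t₀) ^ (k + 1) := by
          gcongr
          linarith [(Nat.cast_nonneg k : (0 : ℝ) ≤ k)]
      _ = _ := by
          rw [hB, Nat.factorial_succ, show n + 1 + (k + 1) = n + 2 + k by omega]
          push_cast
          field_simp
          ring

lemma eq_zero_of_short (ha : IsHomogeneousSolution t₀ t₁ a) (hK : 1 ≤ K) (hC : 0 ≤ C)
    (h₀ : ∀ n, a n t₀ = 0) (hbd : ∀ n, ∀ t ∈ Set.Icc t₀ t₁, |a n t| ≤ C * K ^ n)
    (hshort : 8 * K * (t₁ - t₀) ≤ 1) (n : ℕ) {t : ℝ} (ht : t ∈ Set.Icc t₀ t₁) : a n t = 0 := by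
  have hpos : 0 ≤ t - t₀ := sub_nonneg.2 ht.1
  have hratio : 2 * Real.exp 1 * K * (t - t₀) ≤ 3 / 4 := by
    calc 2 * Real.exp 1 * K * (t - t₀) ≤ 2 * 3 * K * (t₁ - t₀) := by
          gcongr
          · exact Real.exp_one_lt_three.le
          · exact ht.2
      _ ≤ 3 / 4 := by linarith
  have hle : ∀ k : ℕ, |a n t| ≤ C * (Real.exp 1 * K) ^ n * (3 / 4) ^ k := fun k => by
    calc |a n t| ≤ C * K ^ (n + k) * ((2 * (n + k)) ^ k / k.factorial) * (t - t₀) ^ k :=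
          ha.abs_le_iterate hK hC h₀ hbd k n t ht
      _ = C * K ^ (n + k) * 2 ^ k * (t - t₀) ^ k * (((n : ℝ) + k) ^ k / k.factorial) := by
          rw [mul_pow]
          ring
      _ ≤ C * K ^ (n + k) * 2 ^ k * (t - t₀) ^ k * Real.exp (n + k) := by
          gcongr
          exact Real.pow_div_factorial_le_exp _ (by positivity) k
      _ = C * (Real.exp 1 * K) ^ n * (2 * Real.exp 1 * K * (t - t₀)) ^ k := by
          have hexp : Real.exp (n + k) = Real.exp 1 ^ n * Real.exp 1 ^ k := by
            rw [Real.exp_add, Real.exp_one_pow, Real.exp_one_pow]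
          rw [hexp]
          simp only [mul_pow, pow_add]
          ring
      _ ≤ C * (Real.exp 1 * K) ^ n * (3 / 4) ^ k := by gcongr
  have hlim : Tendsto (fun k : ℕ => C * (Real.exp 1 * K) ^ n * (3 / 4 : ℝ) ^ k) atTop (𝓝 0) := by
    simpa using (tendsto_pow_atTop_nhds_zero_of_lt_one (by norm_num : (0 : ℝ) ≤ 3 / 4)
      (by norm_num)).const_mul (C * (Real.exp 1 * K) ^ n)
  exact abs_nonpos_iff.1 (ge_of_tendsto' hlim hle)

lemma eq_zero (ha : IsHomogeneousSolution t₀ t₁ a) (hK : 1 ≤ K) (hC : 0 ≤ C)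
    (h₀ : ∀ n, a n t₀ = 0) (hbd : ∀ n, ∀ t ∈ Set.Icc t₀ t₁, |a n t| ≤ C * K ^ n)
    (n : ℕ) {t : ℝ} (ht : t ∈ Set.Icc t₀ t₁) : a n t = 0 := by
  set δ : ℝ := 1 / (8 * K) with hδ
  have hδ₀ : 0 < δ := by positivity
  have hsteps : ∀ j : ℕ, ∀ n, ∀ t ∈ Set.Icc t₀ t₁, t ≤ t₀ + j * δ → a n t = 0 := by
    intro j
    induction j with
    | zero =>
      intro n t ht hj
      rw [le_antisymm (by simpa using hj) ht.1, h₀]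
    | succ j ih =>
      intro n t ht hj
      push_cast at hj
      rcases le_total t (t₀ + j * δ) with hle | hge
      · exact ih n t ht hle
      have hsub : Set.Icc (t₀ + j * δ) t ⊆ Set.Icc t₀ t₁ :=
        Set.Icc_subset_Icc (by linarith [mul_nonneg j.cast_nonneg hδ₀.le]) ht.2
      refine (ha.mono hsub).eq_zero_of_short hK hC
        (fun m => ih m _ (hsub ⟨le_rfl, hge⟩) le_rfl) (fun m x hx => hbd m x (hsub hx)) ?_ n
        ⟨hge, le_rfl⟩
      calc 8 * K * (t - (t₀ + j * δ)) ≤ 8 * K * δ := by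
            gcongr
            linarith
        _ = 1 := by
            rw [hδ]
            field_simp
  obtain ⟨j, hj⟩ := exists_nat_ge ((t - t₀) / δ)
  rw [div_le_iff₀ hδ₀] at hj
  exact hsteps j n t ht (by linarith)

end IsHomogeneousSolution

namespace IsForcedSolution

variable {w : ℝ → ℝ} {t₀ : ℝ} {α : ℕ+ → ℝ} {a b : ℕ → ℝ → ℝ}

lemma intervalIntegrable_drift (ha : IsForcedSolution w t₀ α a) (n : ℕ) {s t : ℝ}
    (hs : t₀ ≤ s) (ht : t₀ ≤ t) : IntervalIntegrable (drift a n) volume s t :=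
  ((continuousOn_drift ha.continuous n).mono fun _ hx =>
    (le_inf hs ht).trans hx.1).intervalIntegrable

lemma sub_eq_integral_drift (ha : IsForcedSolution w t₀ α a) {n : ℕ} (hn : 1 ≤ n) {s t : ℝ}
    (hs : t₀ ≤ s) (ht : t₀ ≤ t) :
    a n t - a n s = (∫ x in s..t, drift a n x) + if n = 1 then w t - w s else 0 := by
  have hadd := intervalIntegral.integral_add_adjacent_intervals
    (ha.intervalIntegrable_drift n le_rfl hs) (ha.intervalIntegrable_drift n hs ht)
  have heqs : a n s = a n t₀ + (∫ x in t₀..s, drift a n x) + _ := ha.equation n hn s hs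
  have heqt : a n t = a n t₀ + (∫ x in t₀..t, drift a n x) + _ := ha.equation n hn t ht
  rw [heqs, heqt, ← hadd]
  split_ifs <;> ring

lemma isHomogeneousSolution_sub (ha : IsForcedSolution w t₀ α a) (hb : IsForcedSolution w t₀ α b)
    (t₁ : ℝ) : IsHomogeneousSolution t₀ t₁ (b - a) where
  boundary t ht := by simp [ha.boundary t ht.1, hb.boundary t ht.1]
  continuousOn n := ((hb.continuous n).sub (ha.continuous n)).mono Set.Icc_subset_Ici_self
  equation n hn s hs t ht := by
    have hint : ∫ x in s..t, drift (b - a) n x =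
        (∫ x in s..t, drift b n x) - ∫ x in s..t, drift a n x := by
      rw [← intervalIntegral.integral_sub (hb.intervalIntegrable_drift n hs.1 ht.1)
        (ha.intervalIntegrable_drift n hs.1 ht.1), drift_sub]
      rfl
    rw [hint, eq_sub_of_add_eq (hb.sub_eq_integral_drift hn hs.1 ht.1).symm,
      eq_sub_of_add_eq (ha.sub_eq_integral_drift hn hs.1 ht.1).symm]
    simp only [Pi.sub_apply]
    ring

lemma exists_abs_le (ha : IsForcedSolution w t₀ α a) {t : ℝ} (ht : t₀ ≤ t) :
    ∃ C K : ℝ, 0 ≤ C ∧ 1 ≤ K ∧ ∀ n, ∀ s ∈ Set.Icc t₀ t, |a n s| ≤ C * K ^ n := by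
  obtain ⟨C, K, hCK⟩ := ha.growth t ht
  refine ⟨|C|, |K| + 1, abs_nonneg C, by simp, fun n s hs => (hCK n s hs).trans ?_⟩
  calc C * K ^ n ≤ |C * K ^ n| := le_abs_self _
    _ = |C| * |K| ^ n := by rw [abs_mul, abs_pow]
    _ ≤ |C| * (|K| + 1) ^ n := by gcongr; linarith

theorem unique (ha : IsForcedSolution w t₀ α a) (hb : IsForcedSolution w t₀ α b) (n : ℕ) {t : ℝ}
    (ht : t₀ ≤ t) : b n t = a n t := by
  obtain ⟨C, K, hC, hK, hCK⟩ := ha.exists_abs_le ht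
  obtain ⟨C', K', hC', hK', hCK'⟩ := hb.exists_abs_le ht
  have hinit : ∀ m, (b - a) m t₀ = 0 := fun m => by
    rcases Nat.eq_zero_or_pos m with rfl | hm
    · simp [ha.boundary, hb.boundary]
    · exact sub_eq_zero.2 ((hb.initial ⟨m, hm⟩).trans (ha.initial ⟨m, hm⟩).symm)
  refine sub_eq_zero.1 ((ha.isHomogeneousSolution_sub hb t).eq_zero (C := C' + C) (K := max K' K)
    (le_max_of_le_left hK') (by positivity) hinit (fun m s hs => ?_) n ⟨ht, le_rfl⟩)
  calc |(b - a) m s| ≤ |b m s| + |a m s| := abs_sub _ _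
    _ ≤ C' * K' ^ m + C * K ^ m := add_le_add (hCK' m s hs) (hCK m s hs)
    _ ≤ C' * max K' K ^ m + C * max K' K ^ m := by
      gcongr
      · exact le_max_left _ _
      · exact le_max_right _ _
    _ = (C' + C) * max K' K ^ m := by ring

end IsForcedSolution

/-! ### Transport along the Möbius flow -/

lemma hasDerivAt_intervalIntegral_of_continuousOn {E : Type*} [NormedAddCommGroup E]
    [NormedSpace ℝ E] {F F' : ℝ → ℝ → E} {S : Set ℝ} {a b x₀ : ℝ} (hS : S ∈ 𝓝 x₀)
    (hF : ContinuousOn (Function.uncurry F) (S ×ˢ Set.uIcc a b))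
    (hF' : ContinuousOn (Function.uncurry F') (S ×ˢ Set.uIcc a b))
    (hderiv : ∀ x ∈ S, ∀ t ∈ Set.uIcc a b, HasDerivAt (fun y => F y t) (F' x t) x) :
    HasDerivAt (fun x => ∫ t in a..b, F x t) (∫ t in a..b, F' x₀ t) x₀ := by
  obtain ⟨ε, hε, hball⟩ := Metric.nhds_basis_closedBall.mem_iff.1 hS
  obtain ⟨B, hB⟩ := ((isCompact_closedBall x₀ ε).prod isCompact_uIcc).exists_bound_of_continuousOn
    (hF'.mono (Set.prod_mono_left hball))
  have hslice : ∀ {H : ℝ → ℝ → E}, ContinuousOn (Function.uncurry H) (S ×ˢ Set.uIcc a b) →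
      ∀ x ∈ S, ContinuousOn (H x) (Set.uIcc a b) := fun hH x hx =>
    hH.comp (by fun_prop : ContinuousOn (fun t => (x, t)) _) fun t ht => ⟨hx, ht⟩
  have hmeas : ∀ {H : ℝ → ℝ → E}, ContinuousOn (Function.uncurry H) (S ×ˢ Set.uIcc a b) →
      ∀ x ∈ S, AEStronglyMeasurable (H x) (volume.restrict (Set.uIoc a b)) := fun hH x hx =>
    ((hslice hH x hx).mono Set.uIoc_subset_uIcc).aestronglyMeasurable measurableSet_uIoc
  have hx₀ := mem_of_mem_nhds hS
  exact (intervalIntegral.hasDerivAt_integral_of_dominated_loc_of_deriv_le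
    (Metric.closedBall_mem_nhds x₀ hε) (eventually_of_mem hS (hmeas hF))
    (hslice hF x₀ hx₀).intervalIntegrable (hmeas hF' x₀ hx₀)
    (ae_of_all _ fun t ht x hx => hB (x, t) ⟨hx, Set.uIoc_subset_uIcc ht⟩)
    intervalIntegrable_const
    (ae_of_all _ fun t ht x hx => hderiv x (hball hx) t (Set.uIoc_subset_uIcc ht))).2

lemma hasDerivAt_circleIntegral_of_continuousOn {F F' : ℝ → ℂ → ℂ} {S : Set ℝ} {x₀ r : ℝ}
    (hr : 0 ≤ r) (hS : S ∈ 𝓝 x₀)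
    (hF : ContinuousOn (Function.uncurry F) (S ×ˢ Metric.sphere 0 r))
    (hF' : ContinuousOn (Function.uncurry F') (S ×ˢ Metric.sphere 0 r))
    (hderiv : ∀ x ∈ S, ∀ z ∈ Metric.sphere (0 : ℂ) r, HasDerivAt (fun y => F y z) (F' x z) x) :
    HasDerivAt (fun x => ∮ z in C(0, r), F x z) (∮ z in C(0, r), F' x₀ z) x₀ := by
  have hparam : ∀ {H : ℝ → ℂ → ℂ},
      ContinuousOn (Function.uncurry H) (S ×ˢ Metric.sphere 0 r) →
      ContinuousOn (Function.uncurry fun x θ => deriv (circleMap 0 r) θ • H x (circleMap 0 r θ))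
        (S ×ˢ Set.uIcc 0 (2 * Real.pi)) := fun {H} hH => by
    have hcomp : ContinuousOn (fun p : ℝ × ℝ => H p.1 (circleMap 0 r p.2))
        (S ×ˢ Set.uIcc 0 (2 * Real.pi)) :=
      hH.comp (f := fun p : ℝ × ℝ => (p.1, circleMap 0 r p.2)) (by fun_prop)
        fun p hp => ⟨hp.1, circleMap_mem_sphere _ hr _⟩
    simp only [deriv_circleMap]
    exact ContinuousOn.smul (f := fun p : ℝ × ℝ => circleMap 0 r p.2 * Complex.I) (by fun_prop)
      hcomp
  exact hasDerivAt_intervalIntegral_of_continuousOn hS (hparam hF) (hparam hF')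
    fun x hx θ _ => (hderiv x hx _ (circleMap_mem_sphere _ hr θ)).fun_const_smul _

/-- The coefficient of `z ^ n` in the Taylor expansion of `f` at `0`. -/
noncomputable def taylorCoeff (f : ℂ → ℂ) (n : ℕ) : ℂ := iteratedDeriv n f 0 / n.factorial

lemma taylorCoeff_eq_of_hasSum {f : ℂ → ℂ} {c : ℕ → ℂ}
    (h : ∀ᶠ z in 𝓝 0, HasSum (fun k => c k * z ^ k) (f z)) (n : ℕ) : taylorCoeff f n = c n := by
  have hp : HasFPowerSeriesAt f (FormalMultilinearSeries.ofScalars ℂ c) 0 := by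
    refine hasFPowerSeriesAt_iff.2 (h.mono fun z hz => ?_)
    simpa [FormalMultilinearSeries.coeff_ofScalars, mul_comm] using hz
  have hp' := hp.analyticAt.hasFPowerSeriesAt
  have := congrArg (fun p => p.coeff n) (hp'.eq_formalMultilinearSeries hp)
  simpa [taylorCoeff, FormalMultilinearSeries.coeff_ofScalars] using this

lemma norm_taylorCoeff_le {f : ℂ → ℂ} {r M : ℝ} (hr : 0 < r)
    (hf : DifferentiableOn ℂ f (Metric.closedBall 0 r))
    (hM : ∀ z ∈ Metric.closedBall 0 r, ‖f z‖ ≤ M) (n : ℕ) : ‖taylorCoeff f n‖ ≤ M / r ^ n := by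
  have h := Complex.norm_iteratedDeriv_le_of_forall_mem_sphere_norm_le n hr
    (hf.diffContOnCl_ball subset_rfl) fun z hz => hM z (Metric.sphere_subset_closedBall hz)
  rw [taylorCoeff, norm_div, Complex.norm_natCast, div_le_iff₀ (by positivity)]
  exact h.trans_eq (by ring)

lemma taylorCoeff_eq_circleIntegral {f : ℂ → ℂ} {r : ℝ} (hr : 0 < r)
    (hf : DifferentiableOn ℂ f (Metric.closedBall 0 r)) (n : ℕ) :
    taylorCoeff f n =
      (2 * Real.pi * Complex.I)⁻¹ * ∮ z in C(0, r), z ^ (-(n : ℤ) - 1) * f z := by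
  have h := DiffContOnCl.circleIntegral_one_div_sub_center_pow_smul hr n
    (hf.diffContOnCl_ball subset_rfl)
  have hpow : ∀ z : ℂ, z ^ (-(n : ℤ) - 1) = 1 / (z - 0) ^ (n + 1) := fun z => by
    rw [sub_zero, one_div, ← zpow_natCast, ← zpow_neg]
    congr 1
    push_cast
    ring
  simp only [smul_eq_mul] at h
  simp only [hpow, h, taylorCoeff]
  have := Complex.two_pi_I_ne_zero
  field_simp

lemma circleIntegral_transport {u u' : ℂ → ℂ} {r : ℝ} (hr : 0 < r)
    (hderiv : ∀ z ∈ Metric.sphere (0 : ℂ) r, HasDerivAt u (u' z) z)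
    (hcont : ContinuousOn u' (Metric.sphere 0 r)) (k : ℤ) :
    ∮ z in C(0, r), z ^ (-k - 1) * ((z ^ 2 - 1) * u' z + z * u z) =
      k * (∮ z in C(0, r), z ^ (-k) * u z) - (k + 1) * ∮ z in C(0, r), z ^ (-k - 2) * u z := by
  have hne : ∀ z ∈ Metric.sphere (0 : ℂ) r, z ≠ 0 := fun z hz =>
    ne_zero_of_mem_sphere hr.ne' ⟨z, hz⟩
  have hzpow : ∀ j : ℤ, ContinuousOn (fun z : ℂ => z ^ j) (Metric.sphere 0 r) := fun j =>
    continuousOn_id.zpow₀ j fun z hz => Or.inl (hne z hz)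
  have hu : ContinuousOn u (Metric.sphere 0 r) := fun z hz =>
    (hderiv z hz).continuousAt.continuousWithinAt
  have hterm : ∀ (c : ℂ) (j : ℤ), ContinuousOn (fun z => c * (z ^ j * u z))
      (Metric.sphere 0 r) := fun c j => continuousOn_const.mul ((hzpow j).mul hu)
  have hexact : ∮ z in C(0, r), ((z ^ (-k - 1) * ((z ^ 2 - 1) * u' z + z * u z)) -
      (k * (z ^ (-k) * u z) - (k + 1) * (z ^ (-k - 2) * u z))) = 0 := by
    refine circleIntegral.integral_eq_zero_of_hasDerivWithinAt
      (f := fun z => (z ^ 2 - 1) * z ^ (-k - 1) * u z) hr.le fun z hz => ?_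
    have hz₀ := hne z hz
    refine HasDerivAt.hasDerivWithinAt ((((((hasDerivAt_id z).pow 2).sub_const 1).mul
      (hasDerivAt_zpow (-k - 1) z (Or.inl hz₀))).mul (hderiv z hz)).congr_deriv ?_)
    have hpow_sq : z ^ (-k) = z ^ (-k - 2) * z ^ 2 := by
      rw [← zpow_natCast, ← zpow_add₀ hz₀]; congr 1; push_cast; ring
    have hpow_one : z ^ (-k - 1) = z ^ (-k - 2) * z := by
      rw [← zpow_add_one₀ hz₀]; congr 1; ring
    have hexponent : -k - 1 - 1 = -k - 2 := by ring
    simp only [id, Pi.pow_apply, Pi.mul_apply, hexponent, hpow_sq, hpow_one]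
    push_cast
    ring
  rw [circleIntegral.integral_sub, circleIntegral.integral_sub,
    circleIntegral.integral_const_mul, circleIntegral.integral_const_mul] at hexact
  · exact sub_eq_zero.1 hexact
  · exact (hterm _ _).circleIntegrable hr.le
  · exact (hterm _ _).circleIntegrable hr.le
  · refine ContinuousOn.circleIntegrable hr.le ((hzpow _).mul ?_)
    fun_prop
  · exact ((hterm _ _).sub (hterm _ _)).circleIntegrable hr.le

lemma hasDerivAt_taylorCoeff_of_transport {u u' : ℝ → ℂ → ℂ} {S : Set ℝ} {τ r : ℝ} (hr : 0 < r)
    (hS : S ∈ 𝓝 τ)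
    (hspace : ∀ σ ∈ S, ∀ z ∈ Metric.closedBall (0 : ℂ) r, HasDerivAt (u σ) (u' σ z) z)
    (htime : ∀ σ ∈ S, ∀ z ∈ Metric.closedBall (0 : ℂ) r,
      HasDerivAt (fun σ => u σ z) ((z ^ 2 - 1) * u' σ z + z * u σ z) σ)
    (hu : ContinuousOn (Function.uncurry u) (S ×ˢ Metric.closedBall 0 r))
    (hu' : ContinuousOn (Function.uncurry u') (S ×ˢ Metric.closedBall 0 r)) (n : ℕ) :
    HasDerivAt (fun σ => taylorCoeff (u σ) n)
      (n * taylorCoeff (u τ) (n - 1) - (n + 1) * taylorCoeff (u τ) (n + 1)) τ := by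
  have hcoeff : ∀ σ ∈ S, ∀ m, taylorCoeff (u σ) m =
      (2 * Real.pi * Complex.I)⁻¹ * ∮ z in C(0, r), z ^ (-(m : ℤ) - 1) * u σ z := fun σ hσ m =>
    taylorCoeff_eq_circleIntegral hr
      (fun z hz => (hspace σ hσ z hz).differentiableAt.differentiableWithinAt) m
  have hsub : S ×ˢ Metric.sphere (0 : ℂ) r ⊆ S ×ˢ Metric.closedBall 0 r :=
    Set.prod_mono_right Metric.sphere_subset_closedBall
  have hzpow : ContinuousOn (fun p : ℝ × ℂ => p.2 ^ (-(n : ℤ) - 1)) (S ×ˢ Metric.sphere 0 r) :=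
    continuousOn_snd.zpow₀ _ fun p hp => Or.inl (ne_zero_of_mem_sphere hr.ne' ⟨p.2, hp.2⟩)
  have hτ := mem_of_mem_nhds hS
  have hslice : ContinuousOn (u' τ) (Metric.sphere 0 r) :=
    hu'.comp (f := fun z => (τ, z)) (by fun_prop)
      fun z hz => ⟨hτ, Metric.sphere_subset_closedBall hz⟩
  have hderiv := (hasDerivAt_circleIntegral_of_continuousOn
    (F := fun σ z => z ^ (-(n : ℤ) - 1) * u σ z)
    (F' := fun σ z => z ^ (-(n : ℤ) - 1) * ((z ^ 2 - 1) * u' σ z + z * u σ z)) hr.le hS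
    (hzpow.mul (hu.mono hsub))
    (hzpow.mul (ContinuousOn.add (ContinuousOn.mul (by fun_prop) (hu'.mono hsub))
      (continuousOn_snd.mul (hu.mono hsub))))
    fun σ hσ z hz => (htime σ hσ z (Metric.sphere_subset_closedBall hz)).const_mul _).const_mul
      (2 * Real.pi * Complex.I)⁻¹
  refine (hderiv.congr_of_eventuallyEq (eventually_of_mem hS fun σ hσ => hcoeff σ hσ n)).congr_deriv
    ?_
  rw [circleIntegral_transport hr (fun z hz => hspace τ hτ z (Metric.sphere_subset_closedBall hz))
    hslice, hcoeff τ hτ, hcoeff τ hτ]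
  rcases n with _ | n
  · norm_num
  · push_cast
    ring_nf

/-- The denominator of the Möbius flow of `∂_τ z = z² - 1`, which carries the generating function
of the homogeneous system. -/
noncomputable def flowDenom (τ : ℝ) (z : ℂ) : ℂ := Real.cosh τ - z * Real.sinh τ

/-- The Möbius flow `z ↦ (z cosh τ - sinh τ) / (cosh τ - z sinh τ)` of `∂_τ z = z² - 1`, with junk
value `0` at its pole. -/
noncomputable def flow (τ : ℝ) (z : ℂ) : ℂ := (z * Real.cosh τ - Real.sinh τ) / flowDenom τ z

/-- The solution `u(τ, z) = G(flow τ z) / (cosh τ - z sinh τ)` of the transport equation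
`∂_τ u = (z² - 1) ∂_z u + z u` with `u(0, z) = G(z)`. -/
noncomputable def transport (G : ℂ → ℂ) (τ : ℝ) (z : ℂ) : ℂ := G (flow τ z) / flowDenom τ z

/-- The derivative of `transport G τ` in the variable `z`. -/
noncomputable def transportDeriv (G : ℂ → ℂ) (τ : ℝ) (z : ℂ) : ℂ :=
  deriv G (flow τ z) / flowDenom τ z ^ 3 + Real.sinh τ * G (flow τ z) / flowDenom τ z ^ 2

/-- The points `(τ, z)` near which `transport G` is a smooth function. -/
def transportDomain (G : ℂ → ℂ) : Set (ℝ × ℂ) :=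
  {p | flowDenom p.1 p.2 ≠ 0 ∧ AnalyticAt ℂ G (flow p.1 p.2)}

lemma hasDerivAt_flowDenom (τ : ℝ) (z : ℂ) : HasDerivAt (flowDenom τ) (-Real.sinh τ) z :=
  (((hasDerivAt_id z).mul_const (Real.sinh τ : ℂ)).const_sub (Real.cosh τ : ℂ)).congr_deriv
    (by rw [one_mul])

lemma hasDerivAt_flowDenom_time (τ : ℝ) (z : ℂ) :
    HasDerivAt (fun σ => flowDenom σ z) (Real.sinh τ - z * Real.cosh τ) τ :=
  (Real.hasDerivAt_cosh τ).ofReal_comp.sub ((Real.hasDerivAt_sinh τ).ofReal_comp.const_mul z)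

lemma ofReal_cosh_sq (τ : ℝ) : (Real.cosh τ : ℂ) ^ 2 = Real.sinh τ ^ 2 + 1 := by
  exact_mod_cast Real.cosh_sq τ

lemma hasDerivAt_flow {τ : ℝ} {z : ℂ} (h : flowDenom τ z ≠ 0) :
    HasDerivAt (flow τ) (1 / flowDenom τ z ^ 2) z := by
  have hnum := ((hasDerivAt_id z).mul_const (Real.cosh τ : ℂ)).sub_const (Real.sinh τ : ℂ)
  refine (hnum.div (hasDerivAt_flowDenom τ z) h).congr_deriv ?_
  congr 1
  rw [flowDenom]
  simp only [id]
  linear_combination ofReal_cosh_sq τ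

lemma hasDerivAt_flow_time {τ : ℝ} {z : ℂ} (h : flowDenom τ z ≠ 0) :
    HasDerivAt (fun σ => flow σ z) ((z ^ 2 - 1) / flowDenom τ z ^ 2) τ := by
  have hnum := ((Real.hasDerivAt_cosh τ).ofReal_comp.const_mul z).sub
    (Real.hasDerivAt_sinh τ).ofReal_comp
  refine (hnum.div (hasDerivAt_flowDenom_time τ z) h).congr_deriv ?_
  congr 1
  rw [flowDenom]
  simp only [Pi.sub_apply]
  linear_combination (z ^ 2 - 1) * ofReal_cosh_sq τ

lemma continuous_flowDenom : Continuous fun p : ℝ × ℂ => flowDenom p.1 p.2 := by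
  have := Real.continuous_cosh
  have := Real.continuous_sinh
  unfold flowDenom
  fun_prop

lemma continuousOn_flow :
    ContinuousOn (fun p : ℝ × ℂ => flow p.1 p.2) {p | flowDenom p.1 p.2 ≠ 0} := by
  have := Real.continuous_cosh
  have := Real.continuous_sinh
  exact ContinuousOn.div (by fun_prop) continuous_flowDenom.continuousOn fun p hp => hp

section Transport

variable {G : ℂ → ℂ}

lemma isOpen_transportDomain : IsOpen (transportDomain G) :=
  continuousOn_flow.isOpen_inter_preimage (isOpen_ne_fun continuous_flowDenom continuous_const)
    (isOpen_analyticAt ℂ G)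

lemma hasDerivAt_transport {τ : ℝ} {z : ℂ} (h : (τ, z) ∈ transportDomain G) :
    HasDerivAt (transport G τ) (transportDeriv G τ z) z := by
  have hne : flowDenom τ z ≠ 0 := h.1
  refine (((h.2.differentiableAt.hasDerivAt).comp z (hasDerivAt_flow hne)).div
    (hasDerivAt_flowDenom τ z) hne).congr_deriv ?_
  simp only [transportDeriv, Function.comp_apply]
  field_simp
  ring

lemma hasDerivAt_transport_time {τ : ℝ} {z : ℂ} (h : (τ, z) ∈ transportDomain G) :
    HasDerivAt (fun σ => transport G σ z)
      ((z ^ 2 - 1) * transportDeriv G τ z + z * transport G τ z) τ := by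
  have hne : flowDenom τ z ≠ 0 := h.1
  refine (((h.2.differentiableAt.hasDerivAt).comp τ (hasDerivAt_flow_time hne)).div
    (hasDerivAt_flowDenom_time τ z) hne).congr_deriv ?_
  have hden : flowDenom τ z = Real.cosh τ - z * Real.sinh τ := rfl
  simp only [transportDeriv, transport, Function.comp_apply]
  field_simp
  rw [hden]
  ring

lemma continuousOn_transport : ContinuousOn (Function.uncurry (transport G)) (transportDomain G) :=
  fun _ hp => ((ContinuousAt.comp (f := fun p : ℝ × ℂ => flow p.1 p.2) hp.2.continuousAt
    (continuousOn_flow.continuousAt ((isOpen_ne_fun continuous_flowDenom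
      continuous_const).mem_nhds hp.1))).div
    continuous_flowDenom.continuousAt hp.1).continuousWithinAt

lemma continuousOn_transportDeriv :
    ContinuousOn (Function.uncurry (transportDeriv G)) (transportDomain G) := by
  intro p hp
  have hflow : ContinuousAt (fun p : ℝ × ℂ => flow p.1 p.2) p :=
    continuousOn_flow.continuousAt
      ((isOpen_ne_fun continuous_flowDenom continuous_const).mem_nhds hp.1)
  have hden := continuous_flowDenom.continuousAt (x := p)
  have hsinh : ContinuousAt (fun p : ℝ × ℂ => (Real.sinh p.1 : ℂ)) p :=
    (Complex.continuous_ofReal.comp (Real.continuous_sinh.comp continuous_fst)).continuousAt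
  exact (((ContinuousAt.comp (f := fun p : ℝ × ℂ => flow p.1 p.2) hp.2.deriv.continuousAt
    hflow).div (hden.pow 3) (pow_ne_zero 3 hp.1)).add
    ((hsinh.mul (ContinuousAt.comp (f := fun p : ℝ × ℂ => flow p.1 p.2) hp.2.continuousAt
      hflow)).div (hden.pow 2) (pow_ne_zero 2 hp.1))).continuousWithinAt

lemma hasDerivAt_taylorCoeff_transport {τ : ℝ} (h : (τ, 0) ∈ transportDomain G) (n : ℕ) :
    HasDerivAt (fun σ => taylorCoeff (transport G σ) n)
      (n * taylorCoeff (transport G τ) (n - 1) - (n + 1) * taylorCoeff (transport G τ) (n + 1))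
      τ := by
  obtain ⟨r, hr, hball⟩ := Metric.nhds_basis_closedBall.mem_iff.1
    (isOpen_transportDomain.mem_nhds h)
  rw [← closedBall_prod_same] at hball
  exact hasDerivAt_taylorCoeff_of_transport hr (Metric.closedBall_mem_nhds τ hr)
    (fun σ hσ z hz => hasDerivAt_transport (hball ⟨hσ, hz⟩))
    (fun σ hσ z hz => hasDerivAt_transport_time (hball ⟨hσ, hz⟩))
    (continuousOn_transport.mono hball) (continuousOn_transportDeriv.mono hball) n

lemma exists_norm_taylorCoeff_transport_le {S : Set ℝ} (hS : IsCompact S)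
    (h : ∀ τ ∈ S, (τ, 0) ∈ transportDomain G) :
    ∃ M r : ℝ, 0 < r ∧ ∀ n, ∀ τ ∈ S, ‖taylorCoeff (transport G τ) n‖ ≤ M / r ^ n := by
  obtain ⟨U, V, -, hV, hSU, h0V, hUV⟩ := generalized_tube_lemma hS isCompact_singleton
    isOpen_transportDomain (Set.prod_subset_iff.2 fun τ hτ z hz => by
      rw [Set.mem_singleton_iff.1 hz]
      exact h τ hτ)
  obtain ⟨r, hr, hball⟩ := Metric.nhds_basis_closedBall.mem_iff.1
    (hV.mem_nhds (Set.singleton_subset_iff.1 h0V))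
  have hsub : S ×ˢ Metric.closedBall 0 r ⊆ transportDomain G :=
    (Set.prod_mono hSU hball).trans hUV
  obtain ⟨M, hM⟩ := (hS.prod (isCompact_closedBall (0 : ℂ) r)).exists_bound_of_continuousOn
    (continuousOn_transport.mono hsub)
  exact ⟨M, r, hr, fun n τ hτ => norm_taylorCoeff_le hr
    (fun z hz => (hasDerivAt_transport (hsub ⟨hτ, hz⟩)).differentiableAt.differentiableWithinAt)
    (fun z hz => hM (τ, z) ⟨hτ, hz⟩) n⟩

end Transport

lemma flow_zero (τ : ℝ) : flow τ 0 = (-Real.tanh τ : ℝ) := by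
  simp [flow, flowDenom, Real.tanh_eq_sinh_div_cosh, neg_div]

lemma flowDenom_zero (τ : ℝ) : flowDenom τ 0 = Real.cosh τ := by
  simp [flowDenom]

lemma transport_zero (G : ℂ → ℂ) : transport G 0 = G := by
  ext z
  simp [transport, flow, flowDenom]

lemma flowDenom_eq_cosh_mul (τ : ℝ) (z : ℂ) :
    flowDenom τ z = Real.cosh τ * (1 - z * Real.tanh τ) := by
  have : (Real.cosh τ : ℂ) ≠ 0 := Complex.ofReal_ne_zero.2 (Real.cosh_pos τ).ne'
  rw [flowDenom, Real.tanh_eq_sinh_div_cosh, Complex.ofReal_div]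
  field_simp

lemma norm_mul_tanh_le (τ : ℝ) (z : ℂ) : ‖z * Real.tanh τ‖ ≤ ‖z‖ := by
  rw [norm_mul, Complex.norm_real]
  exact mul_le_of_le_one_right (norm_nonneg z) (Real.abs_tanh_lt_one τ).le

lemma one_sub_norm_le_norm_one_sub_mul_tanh (τ : ℝ) (z : ℂ) :
    1 - ‖z‖ ≤ ‖1 - z * Real.tanh τ‖ := by
  have h := norm_sub_norm_le (1 : ℂ) (z * Real.tanh τ)
  rw [norm_one] at h
  linarith [norm_mul_tanh_le τ z]

lemma flow_add_one {τ : ℝ} {z : ℂ} (h : flowDenom τ z ≠ 0) :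
    flow τ z + 1 =
      (Real.exp (-τ) / Real.cosh τ : ℝ) * ((1 + z) / (1 - z * Real.tanh τ)) := by
  have hexp : (Real.exp (-τ) : ℂ) = Real.cosh τ - Real.sinh τ := by
    rw [← Real.cosh_sub_sinh, Complex.ofReal_sub]
  rw [Complex.ofReal_div, div_mul_div_comm, ← flowDenom_eq_cosh_mul, flow, eq_div_iff h, add_mul,
    div_mul_cancel₀ _ h, hexp, flowDenom]
  ring

lemma norm_div_one_sub_mul_tanh_sub_one_le {τ ε : ℝ} {z : ℂ} (hε : ε ≤ 1) (hz : ‖z‖ ≤ ε / 4) :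
    ‖(1 + z) / (1 - z * Real.tanh τ) - 1‖ ≤ 2 * ε / 3 := by
  have hden : 3 / 4 ≤ ‖1 - z * Real.tanh τ‖ := by
    linarith [one_sub_norm_le_norm_one_sub_mul_tanh τ z]
  have hne : 1 - z * Real.tanh τ ≠ 0 := norm_pos_iff.1 (by linarith)
  rw [div_sub_one hne, norm_div, div_le_iff₀ (by linarith)]
  calc ‖1 + z - (1 - z * Real.tanh τ)‖ = ‖z + z * Real.tanh τ‖ := by ring_nf
    _ ≤ ‖z‖ + ‖z‖ := norm_add_le_of_le le_rfl (norm_mul_tanh_le τ z)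
    _ ≤ 2 * ε / 3 * ‖1 - z * Real.tanh τ‖ := by nlinarith [norm_nonneg z]

lemma half_cosh_le_norm_flowDenom {τ : ℝ} {z : ℂ} (hz : ‖z‖ ≤ 1 / 2) :
    Real.cosh τ / 2 ≤ ‖flowDenom τ z‖ := by
  have hcosh := Real.cosh_pos τ
  rw [flowDenom_eq_cosh_mul, norm_mul, Complex.norm_real, Real.norm_of_nonneg hcosh.le]
  nlinarith [one_sub_norm_le_norm_one_sub_mul_tanh τ z]

-- `flow τ z + 1` is a small positive multiple of a point close to `1`, uniformly in small `z`.
lemma exists_flow_mem_sector {δ θ : ℝ} (hδ : 0 < δ) (hθ : 0 < θ) :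
    ∃ ρ > 0, ρ ≤ 1 / 4 ∧ ∀ᶠ τ in atTop, ∀ z ∈ Metric.closedBall (0 : ℂ) ρ,
      0 < ‖flow τ z + 1‖ ∧ ‖flow τ z + 1‖ < δ ∧ |Complex.arg (flow τ z + 1)| < θ := by
  have harg : ∀ᶠ w in 𝓝 (1 : ℂ), |Complex.arg w| < θ :=
    (Complex.continuousAt_arg Complex.one_mem_slitPlane).abs.eventually_lt continuousAt_const
      (by simpa using hθ)
  obtain ⟨η, hη, harg⟩ := Metric.eventually_nhds_iff.1 harg
  set ε := min η 1
  have hε : 0 < ε := lt_min hη one_pos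
  have hε₁ : ε ≤ 1 := min_le_right _ _
  have hdecay : ∀ᶠ τ : ℝ in atTop, Real.exp (-τ) < δ / 2 :=
    Real.tendsto_exp_neg_atTop_nhds_zero.eventually_lt_const (by positivity)
  refine ⟨ε / 4, by positivity, by linarith, hdecay.mono fun τ hτ z hz => ?_⟩
  rw [mem_closedBall_zero_iff] at hz
  set w : ℂ := (1 + z) / (1 - z * Real.tanh τ)
  have hw₁ : ‖w - 1‖ ≤ 2 * ε / 3 := norm_div_one_sub_mul_tanh_sub_one_le hε₁ hz
  have hlow : 1 - ‖w‖ ≤ ‖w - 1‖ := by simpa [norm_sub_rev] using norm_sub_norm_le 1 w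
  have hupp : ‖w‖ - 1 ≤ ‖w - 1‖ := by simpa using norm_sub_norm_le w 1
  set s := Real.exp (-τ) / Real.cosh τ
  have hs : 0 < s := div_pos (Real.exp_pos _) (Real.cosh_pos τ)
  have hsδ : s < δ / 2 := (div_le_self (Real.exp_pos _).le (Real.one_le_cosh τ)).trans_lt hτ
  have hden := half_cosh_le_norm_flowDenom (τ := τ) (z := z) (by linarith)
  have hflow : flow τ z + 1 = s * w :=
    flow_add_one (norm_pos_iff.1 ((half_pos (Real.cosh_pos τ)).trans_le hden))
  rw [hflow, norm_mul, Complex.norm_real, Real.norm_of_nonneg hs.le, Complex.arg_real_mul _ hs]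
  refine ⟨mul_pos hs (by linarith), by nlinarith, harg ?_⟩
  rw [dist_eq_norm]
  linarith [min_le_left η 1]

/-- `G` is analytic on `(-1, 0]` and, in some sector with vertex `-1` around the real axis, it is
analytic and bounded. No limit at `-1` is required. -/
structure IsSectorial (G : ℂ → ℂ) : Prop where
  analyticAt : ∀ x ∈ Set.Ioc (-1 : ℝ) 0, AnalyticAt ℂ G x
  exists_sector : ∃ δ > (0 : ℝ), ∃ θ > (0 : ℝ), ∃ M : ℝ,
    ∀ z : ℂ, 0 < ‖z + 1‖ → ‖z + 1‖ < δ → |Complex.arg (z + 1)| < θ →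
      AnalyticAt ℂ G z ∧ ‖G z‖ ≤ M

lemma tendsto_cosh_atTop : Tendsto Real.cosh atTop atTop := by
  refine tendsto_atTop_mono (fun x => ?_) (Real.tendsto_exp_atTop.atTop_div_const two_pos)
  rw [Real.cosh_eq]
  gcongr
  exact le_add_of_nonneg_right (Real.exp_pos _).le

namespace IsSectorial

variable {G : ℂ → ℂ}

lemma mem_transportDomain (hG : IsSectorial G) {τ : ℝ} (hτ : 0 ≤ τ) :
    (τ, (0 : ℂ)) ∈ transportDomain G := by
  refine ⟨?_, ?_⟩
  · change flowDenom τ 0 ≠ 0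
    rw [flowDenom_zero]
    exact Complex.ofReal_ne_zero.2 (Real.cosh_pos τ).ne'
  · change AnalyticAt ℂ G (flow τ 0)
    rw [flow_zero]
    refine hG.analyticAt _ ⟨neg_lt_neg (Real.tanh_lt_one τ), neg_nonpos.2 ?_⟩
    rw [Real.tanh_eq_sinh_div_cosh]
    exact div_nonneg (Real.sinh_nonneg_iff.2 hτ) (Real.cosh_pos τ).le

lemma exists_norm_transport_le (hG : IsSectorial G) :
    ∃ ρ > 0, ∃ M : ℝ, ∀ᶠ τ in atTop, ∀ z ∈ Metric.closedBall (0 : ℂ) ρ,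
      (τ, z) ∈ transportDomain G ∧ ‖transport G τ z‖ ≤ M / Real.cosh τ := by
  obtain ⟨δ, hδ, θ, hθ, M, hM⟩ := hG.exists_sector
  obtain ⟨ρ, hρ, hρ₄, hsector⟩ := exists_flow_mem_sector hδ hθ
  refine ⟨ρ, hρ, 2 * M, hsector.mono fun τ hτ z hz => ?_⟩
  obtain ⟨hpos, hlt, harg⟩ := hτ z hz
  obtain ⟨han, hle⟩ := hM (flow τ z) hpos hlt harg
  have hcosh := Real.cosh_pos τ
  have hden : Real.cosh τ / 2 ≤ ‖flowDenom τ z‖ :=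
    half_cosh_le_norm_flowDenom (by linarith [mem_closedBall_zero_iff.1 hz])
  refine ⟨⟨norm_pos_iff.1 (by linarith), han⟩, ?_⟩
  calc ‖transport G τ z‖ = ‖G (flow τ z)‖ / ‖flowDenom τ z‖ := norm_div _ _
    _ ≤ M / (Real.cosh τ / 2) :=
      div_le_div₀ ((norm_nonneg _).trans hle) hle (by linarith) hden
    _ = 2 * M / Real.cosh τ := by ring

lemma tendsto_taylorCoeff_transport (hG : IsSectorial G) (n : ℕ) :
    Tendsto (fun τ => taylorCoeff (transport G τ) n) atTop (𝓝 0) := by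
  obtain ⟨ρ, hρ, M, hM⟩ := hG.exists_norm_transport_le
  have hcosh : Tendsto (fun τ => M / Real.cosh τ / ρ ^ n) atTop (𝓝 0) := by
    have := (tendsto_const_nhds (x := M)).div_atTop tendsto_cosh_atTop
    simpa using this.div_const (ρ ^ n)
  refine squeeze_zero_norm' (hM.mono fun τ hτ => ?_) hcosh
  exact norm_taylorCoeff_le hρ (fun z hz =>
    (hasDerivAt_transport (hτ z hz).1).differentiableAt.differentiableWithinAt)
    (fun z hz => (hτ z hz).2) n

end IsSectorial

/-- The solution `a_{k+1}(τ) = Re [z^k] transport G τ z` of the system without noise whose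
generating function at time `0` is `G`. -/
noncomputable def homogeneous (G : ℂ → ℂ) : ℕ → ℝ → ℝ
  | 0, _ => 0
  | k + 1, τ => (taylorCoeff (transport G τ) k).re

section Homogeneous

variable {G : ℂ → ℂ}

lemma homogeneous_zero_right {c : ℕ → ℝ}
    (h : ∀ᶠ z in 𝓝 0, HasSum (fun k => (c k : ℂ) * z ^ k) (G z)) (k : ℕ) :
    homogeneous G (k + 1) 0 = c k := by
  rw [homogeneous, transport_zero, taylorCoeff_eq_of_hasSum h, Complex.ofReal_re]

lemma IsSectorial.hasDerivAt_homogeneous (hG : IsSectorial G) {n : ℕ} (hn : 1 ≤ n) {τ : ℝ}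
    (hτ : 0 ≤ τ) : HasDerivAt (homogeneous G n) (drift (homogeneous G) n τ) τ := by
  obtain ⟨k, rfl⟩ := Nat.exists_eq_add_of_le' hn
  have h := Complex.reCLM.hasFDerivAt.comp_hasDerivAt τ
    (hasDerivAt_taylorCoeff_transport (hG.mem_transportDomain hτ) k)
  refine h.congr_deriv ?_
  rcases k with _ | k <;> simp [drift, homogeneous]

lemma IsSectorial.continuousOn_homogeneous (hG : IsSectorial G) (n : ℕ) :
    ContinuousOn (homogeneous G n) (Set.Ici 0) := by
  rcases n with _ | n
  · exact continuousOn_const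
  · exact fun τ hτ =>
      (hG.hasDerivAt_homogeneous (by omega) hτ).continuousAt.continuousWithinAt

lemma IsSectorial.exists_abs_homogeneous_le (hG : IsSectorial G) (τ₁ : ℝ) :
    ∃ C K : ℝ, 0 ≤ C ∧ 0 ≤ K ∧ ∀ n, ∀ τ ∈ Set.Icc 0 τ₁, |homogeneous G n τ| ≤ C * K ^ n := by
  obtain ⟨M, r, hr, hM⟩ := exists_norm_taylorCoeff_transport_le (S := Set.Icc 0 τ₁) isCompact_Icc
    fun τ hτ => hG.mem_transportDomain hτ.1
  refine ⟨|M| * r, r⁻¹, by positivity, by positivity, fun n τ hτ => ?_⟩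
  rcases n with _ | n
  · rw [homogeneous, abs_zero]
    positivity
  · calc |homogeneous G (n + 1) τ| ≤ ‖taylorCoeff (transport G τ) n‖ := Complex.abs_re_le_norm _
      _ ≤ M / r ^ n := hM n τ hτ
      _ ≤ |M| / r ^ n := by gcongr; exact le_abs_self M
      _ = |M| * r * r⁻¹ ^ (n + 1) := by
        rw [inv_pow, pow_succ]
        field_simp

lemma IsSectorial.tendsto_homogeneous (hG : IsSectorial G) (n : ℕ) :
    Tendsto (homogeneous G n) atTop (𝓝 0) := by
  rcases n with _ | n
  · exact tendsto_const_nhds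
  · exact (Complex.continuous_re.tendsto' 0 0 rfl).comp (hG.tendsto_taylorCoeff_transport n)

end Homogeneous

/-! ### Response to the noise -/

/-- The Green's function `tanh^m / cosh` of the system: the response of `a_{m+1}` to a unit impulse
in `a_1`. -/
noncomputable def green (m : ℕ) (u : ℝ) : ℝ := Real.tanh u ^ m / Real.cosh u

lemma hasDerivAt_tanh (u : ℝ) : HasDerivAt Real.tanh (1 - Real.tanh u ^ 2) u := by
  have hcosh := (Real.cosh_pos u).ne'
  rw [show Real.tanh = Real.sinh / Real.cosh from funext Real.tanh_eq_sinh_div_cosh]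
  refine ((Real.hasDerivAt_sinh u).div (Real.hasDerivAt_cosh u) hcosh).congr_deriv ?_
  rw [Pi.div_apply]
  field_simp

lemma hasDerivAt_green (m : ℕ) (u : ℝ) :
    HasDerivAt (green m) (m * green (m - 1) u - (m + 1) * green (m + 1) u) u := by
  have hcosh := (Real.cosh_pos u).ne'
  have hsinh : Real.sinh u = Real.tanh u * Real.cosh u := by
    rw [Real.tanh_eq_sinh_div_cosh, div_mul_cancel₀ _ hcosh]
  refine HasDerivAt.congr_deriv (f := green m)
    (((hasDerivAt_tanh u).pow m).div (Real.hasDerivAt_cosh u) hcosh) ?_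
  simp only [green, hsinh, Pi.pow_apply]
  rcases m with _ | m
  · simp only [Nat.cast_zero]
    field_simp
    ring
  · simp only [Nat.add_sub_cancel]
    push_cast
    field_simp
    ring

lemma deriv_green (m : ℕ) (u : ℝ) :
    deriv (green m) u = m * green (m - 1) u - (m + 1) * green (m + 1) u :=
  (hasDerivAt_green m u).deriv

lemma contDiff_green (m : ℕ) : ContDiff ℝ 1 (green m) := by
  have hcosh : ∀ u, Real.cosh u ≠ 0 := fun u => (Real.cosh_pos u).ne'
  have htanh : ContDiff ℝ 1 Real.tanh := by
    rw [show Real.tanh = Real.sinh / Real.cosh from funext Real.tanh_eq_sinh_div_cosh]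
    exact Real.contDiff_sinh.div Real.contDiff_cosh hcosh
  exact (htanh.pow m).div Real.contDiff_cosh hcosh

lemma green_zero (m : ℕ) : green m 0 = if m = 0 then 1 else 0 := by
  rcases m with _ | m <;> simp [green]

lemma abs_green_le (m : ℕ) (u : ℝ) : |green m u| ≤ 2 * Real.exp (-u) := by
  have htanh : |Real.tanh u| ^ m ≤ 1 := pow_le_one₀ (abs_nonneg _) (Real.abs_tanh_lt_one u).le
  have hcosh : Real.exp u / 2 ≤ Real.cosh u := by
    rw [Real.cosh_eq]
    linarith [Real.exp_pos (-u)]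
  rw [green, abs_div, abs_pow, abs_of_pos (Real.cosh_pos u)]
  calc |Real.tanh u| ^ m / Real.cosh u ≤ 1 / (Real.exp u / 2) := by gcongr
    _ = 2 * Real.exp (-u) := by
      rw [Real.exp_neg]
      field_simp

lemma abs_deriv_green_le (m : ℕ) (u : ℝ) :
    |deriv (green m) u| ≤ (4 * m + 2) * Real.exp (-u) := by
  rw [deriv_green]
  calc |m * green (m - 1) u - (m + 1) * green (m + 1) u|
      ≤ |m * green (m - 1) u| + |(m + 1) * green (m + 1) u| := abs_sub _ _
    _ = m * |green (m - 1) u| + (m + 1) * |green (m + 1) u| := by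
        rw [abs_mul, abs_mul, Nat.abs_cast, abs_of_nonneg (by positivity : (0 : ℝ) ≤ (m : ℝ) + 1)]
    _ ≤ m * (2 * Real.exp (-u)) + (m + 1) * (2 * Real.exp (-u)) := by
        gcongr <;> exact abs_green_le _ u
    _ = (4 * m + 2) * Real.exp (-u) := by ring

/-- A continuously differentiable function that decays exponentially on `[0, ∞)`, together with its
derivative. These are the kernels `h` for which `∫ h (t - s) dw(s)` over `(-∞, t]` makes sense path
by path. -/
structure IsDecayingKernel (h : ℝ → ℝ) (B : ℝ) : Prop where
  contDiff : ContDiff ℝ 1 h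
  abs_le : ∀ u, 0 ≤ u → |h u| ≤ B * Real.exp (-u)
  abs_deriv_le : ∀ u, 0 ≤ u → |deriv h u| ≤ B * Real.exp (-u)

lemma isDecayingKernel_green (m : ℕ) : IsDecayingKernel (green m) (4 * m + 2) where
  contDiff := contDiff_green m
  abs_le u _ := (abs_green_le m u).trans (by gcongr; linarith [(Nat.cast_nonneg m : (0 : ℝ) ≤ m)])
  abs_deriv_le u _ := abs_deriv_green_le m u

section Response

variable {h : ℝ → ℝ}

lemma hasDerivAt_integral_convolution_endpoint {v : ℝ → ℝ} (hh : Continuous h) (hv : Continuous v)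
    (t₀ x y : ℝ) :
    HasDerivAt (fun x => ∫ s in t₀..x, h (y - s) * v s) (h (y - x) * v x) x := by
  have hcont : Continuous fun s => h (y - s) * v s := by fun_prop
  exact intervalIntegral.integral_hasDerivAt_right (hcont.intervalIntegrable _ _)
    (hcont.stronglyMeasurableAtFilter _ _) hcont.continuousAt

lemma hasDerivAt_integral_convolution_param {v : ℝ → ℝ} (hh : ContDiff ℝ 1 h) (hv : Continuous v)
    (t₀ x y : ℝ) :
    HasDerivAt (fun y => ∫ s in t₀..x, h (y - s) * v s) (∫ s in t₀..x, deriv h (y - s) * v s)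
      y := by
  have := hh.continuous
  have := hh.continuous_deriv le_rfl
  refine hasDerivAt_intervalIntegral_of_continuousOn (F := fun y s => h (y - s) * v s)
    (F' := fun y s => deriv h (y - s) * v s) univ_mem
    (Continuous.continuousOn (by simp only [Function.uncurry_def]; fun_prop))
    (Continuous.continuousOn (by simp only [Function.uncurry_def]; fun_prop))
    fun z _ s _ => ?_
  exact (((hh.differentiable one_ne_zero).differentiableAt.hasDerivAt).comp_sub_const z s).mul_const
    (v s)

lemma hasDerivAt_integral_convolution {v : ℝ → ℝ} (hh : ContDiff ℝ 1 h) (hv : Continuous v)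
    (t₀ t : ℝ) :
    HasDerivAt (fun t => ∫ s in t₀..t, h (t - s) * v s)
      (h 0 * v t + ∫ s in t₀..t, deriv h (t - s) * v s) t := by
  have := hh.continuous
  have := hh.continuous_deriv le_rfl
  have hcont : Continuous fun p : ℝ × ℝ => ∫ s in t₀..p.1, deriv h (p.2 - s) * v s :=
    intervalIntegral.continuous_parametric_intervalIntegral_of_continuous
      (f := fun (p : ℝ × ℝ) s => deriv h (p.2 - s) * v s) (by fun_prop) continuous_fst
  have hspan := (ContinuousLinearMap.toSpanSingletonCLE (𝕜 := ℝ) (E := ℝ)).continuous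
  have hF := hasStrictFDerivAt_uncurry_coprod (𝕜 := ℝ) (u := (t, t))
    (f := fun x y => ∫ s in t₀..x, h (y - s) * v s)
    (f₁ := fun x y => ContinuousLinearMap.toSpanSingleton ℝ (h (y - x) * v x))
    (f₂ := fun x y => ContinuousLinearMap.toSpanSingleton ℝ (∫ s in t₀..x, deriv h (y - s) * v s))
    (Eventually.of_forall fun p =>
      (hasDerivAt_integral_convolution_endpoint hh.continuous hv t₀ p.1 p.2).hasFDerivAt)
    (Eventually.of_forall fun p =>
      (hasDerivAt_integral_convolution_param hh hv t₀ p.1 p.2).hasFDerivAt)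
    (hspan.comp (by fun_prop : Continuous fun p : ℝ × ℝ => h (p.2 - p.1) * v p.1)).continuousAt
    (hspan.comp hcont).continuousAt
  refine HasDerivAt.congr_deriv (f := fun t => ∫ s in t₀..t, h (t - s) * v s)
    (hF.hasFDerivAt.comp_hasDerivAt_of_eq t ((hasDerivAt_id t).prodMk (hasDerivAt_id t)) rfl) ?_
  simp [Function.HasUncurry.uncurry]

/-- The integral `∫ h (t - s) dw(s)` over `[t₀, t]` along a continuous path `w`, defined through
integration by parts. -/
noncomputable def response (h w : ℝ → ℝ) (t₀ t : ℝ) : ℝ :=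
  h 0 * (w t - w t₀) + ∫ s in t₀..t, deriv h (t - s) * (w s - w t₀)

variable {w : ℝ → ℝ}

lemma continuous_response (hh : ContDiff ℝ 1 h) (hw : Continuous w) (t₀ : ℝ) :
    Continuous (response h w t₀) := by
  have := hh.continuous_deriv le_rfl
  have hint : Continuous fun t => ∫ s in t₀..t, deriv h (t - s) * (w s - w t₀) :=
    intervalIntegral.continuous_parametric_intervalIntegral_of_continuous
      (f := fun t s => deriv h (t - s) * (w s - w t₀)) (by fun_prop) continuous_id
  exact (by fun_prop : Continuous fun t => h 0 * (w t - w t₀)).add hint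

lemma abs_response_le {t₀ t D M : ℝ} (ht : t₀ ≤ t)
    (hD : ∀ u ∈ Set.Icc 0 (t - t₀), |deriv h u| ≤ D) (hM : ∀ s ∈ Set.Icc t₀ t, |w s - w t₀| ≤ M) :
    |response h w t₀ t| ≤ (|h 0| + D * (t - t₀)) * M := by
  have hD₀ : 0 ≤ D := (abs_nonneg _).trans (hD 0 ⟨le_rfl, sub_nonneg.2 ht⟩)
  have hint : ‖∫ s in t₀..t, deriv h (t - s) * (w s - w t₀)‖ ≤ D * M * |t - t₀| :=
    intervalIntegral.norm_integral_le_of_norm_le_const fun s hs => by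
      rw [Set.uIoc_of_le ht] at hs
      rw [norm_mul]
      exact mul_le_mul (hD _ ⟨sub_nonneg.2 hs.2, sub_le_sub_left hs.1.le t⟩)
        (hM s ⟨hs.1.le, hs.2⟩) (abs_nonneg _) hD₀
  rw [abs_of_nonneg (sub_nonneg.2 ht)] at hint
  calc |response h w t₀ t|
      ≤ |h 0| * |w t - w t₀| + |∫ s in t₀..t, deriv h (t - s) * (w s - w t₀)| :=
        (abs_add_le _ _).trans_eq (by rw [abs_mul])
    _ ≤ |h 0| * M + D * M * (t - t₀) := by
        gcongr
        · exact hM t ⟨ht, le_rfl⟩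
        · exact hint
    _ = (|h 0| + D * (t - t₀)) * M := by ring

lemma response_eq_integral_increment (hh : ContDiff ℝ 1 h) (hw : Continuous w) (t₀ t : ℝ) :
    response h w t₀ t = h (t - t₀) * (w t - w t₀) -
      ∫ u in (0)..(t - t₀), deriv h u * (w t - w (t - u)) := by
  have hderiv := hh.continuous_deriv le_rfl
  have hsubst : ∫ s in t₀..t, deriv h (t - s) * (w s - w t₀) =
      ∫ u in (0)..(t - t₀), deriv h u * (w (t - u) - w t₀) := by
    simpa using intervalIntegral.integral_comp_sub_left
      (fun u => deriv h u * (w (t - u) - w t₀)) t (a := t₀) (b := t)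
  have hsplit : ∫ u in (0)..(t - t₀), deriv h u * (w (t - u) - w t₀) =
      ∫ u in (0)..(t - t₀), (deriv h u * (w t - w t₀) - deriv h u * (w t - w (t - u))) := by
    congr 1
    ext u
    ring
  have hftc : ∫ u in (0)..(t - t₀), deriv h u = h (t - t₀) - h 0 :=
    intervalIntegral.integral_deriv_eq_sub
      (fun u _ => (hh.differentiable one_ne_zero).differentiableAt)
      (hderiv.intervalIntegrable _ _)
  rw [response, hsubst, hsplit, intervalIntegral.integral_sub
    (Continuous.intervalIntegrable (by fun_prop) _ _)
    (Continuous.intervalIntegrable (by fun_prop) _ _),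
    intervalIntegral.integral_mul_const, hftc]
  ring

end Response

/-- The solution of the system driven by the path `w` with zero initial data at time `t₀`. -/
noncomputable def forced (w : ℝ → ℝ) (t₀ : ℝ) : ℕ → ℝ → ℝ
  | 0, _ => 0
  | m + 1, t => response (green m) w t₀ t

section Forced

variable {w : ℝ → ℝ}

lemma forced_self (t₀ : ℝ) (n : ℕ) : forced w t₀ n t₀ = 0 := by
  rcases n with _ | m <;> simp [forced, response]

lemma continuous_forced (hw : Continuous w) (t₀ : ℝ) (n : ℕ) : Continuous (forced w t₀ n) := by
  rcases n with _ | m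
  · exact continuous_const
  · exact continuous_response (contDiff_green m) hw t₀

lemma integral_deriv_green_mul (hw : Continuous w) (t₀ : ℝ) (m : ℕ) (t : ℝ) :
    ∫ s in t₀..t, deriv (green m) (t - s) * (w s - w t₀) =
      m * (∫ s in t₀..t, green (m - 1) (t - s) * (w s - w t₀)) -
      (m + 1) * ∫ s in t₀..t, green (m + 1) (t - s) * (w s - w t₀) := by
  have hint : ∀ j, IntervalIntegrable (fun s => green j (t - s) * (w s - w t₀)) volume t₀ t :=
    fun j => by
      have := (contDiff_green j).continuous
      exact Continuous.intervalIntegrable (by fun_prop) _ _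
  rw [← intervalIntegral.integral_const_mul, ← intervalIntegral.integral_const_mul,
    ← intervalIntegral.integral_sub ((hint _).const_mul _) ((hint _).const_mul _)]
  congr 1
  ext s
  rw [deriv_green]
  ring

lemma hasDerivAt_integral_deriv_green_mul (hw : Continuous w) (t₀ : ℝ) (m : ℕ) (t : ℝ) :
    HasDerivAt (fun t => ∫ s in t₀..t, deriv (green m) (t - s) * (w s - w t₀))
      (drift (forced w t₀) (m + 1) t) t := by
  have hderiv : ∀ j, HasDerivAt (fun t => ∫ s in t₀..t, green j (t - s) * (w s - w t₀))
      (forced w t₀ (j + 1) t) t := fun j =>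
    hasDerivAt_integral_convolution (contDiff_green j) (by fun_prop) t₀ t
  rw [funext (integral_deriv_green_mul hw t₀ m)]
  refine (((hderiv (m - 1)).const_mul (m : ℝ)).sub
    ((hderiv (m + 1)).const_mul ((m : ℝ) + 1))).congr_deriv ?_
  rcases m with _ | m <;> simp [drift]

lemma forced_eq_integral_drift (hw : Continuous w) (t₀ : ℝ) {n : ℕ} (hn : 1 ≤ n) (t : ℝ) :
    forced w t₀ n t =
      (∫ s in t₀..t, drift (forced w t₀) n s) + if n = 1 then w t - w t₀ else 0 := by
  obtain ⟨m, rfl⟩ := Nat.exists_eq_add_of_le' hn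
  have hdrift : Continuous (drift (forced w t₀) (m + 1)) := continuousOn_univ.1
    (continuousOn_drift (fun j => (continuous_forced hw t₀ j).continuousOn) _)
  rw [intervalIntegral.integral_eq_sub_of_hasDerivAt
    (fun s _ => hasDerivAt_integral_deriv_green_mul hw t₀ m s) (hdrift.intervalIntegrable _ _),
    forced, response, green_zero, intervalIntegral.integral_same]
  rcases m with _ | m <;> simp [add_comm]

lemma exists_abs_forced_le (hw : Continuous w) (t₀ t₁ : ℝ) :
    ∃ C : ℝ, 0 ≤ C ∧ ∀ n, ∀ t ∈ Set.Icc t₀ t₁, |forced w t₀ n t| ≤ C * 2 ^ n := by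
  obtain ⟨M, hM⟩ := (isCompact_Icc (a := t₀) (b := t₁)).exists_bound_of_continuousOn
    (f := fun s => w s - w t₀) (by fun_prop)
  refine ⟨(2 + 4 * |t₁ - t₀|) * |M|, by positivity, fun n t ht => ?_⟩
  rcases n with _ | m
  · rw [forced, abs_zero]
    positivity
  have hpow : (m : ℝ) + 1 ≤ 2 ^ (m + 1) := by
    exact_mod_cast (Nat.lt_two_pow_self (n := m + 1)).le
  have hgreen : |green m 0| ≤ 2 := by simpa using abs_green_le m 0
  have ht₀ : t₀ ≤ t := ht.1
  have htime : t - t₀ ≤ |t₁ - t₀| := (sub_le_sub_right ht.2 t₀).trans (le_abs_self _)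
  calc |forced w t₀ (m + 1) t| ≤ (|green m 0| + (4 * m + 2) * (t - t₀)) * |M| :=
        abs_response_le ht.1
          (fun u hu => (abs_deriv_green_le m u).trans (mul_le_of_le_one_right (by positivity)
            (Real.exp_le_one_iff.2 (neg_nonpos.2 hu.1))))
          fun s hs => (hM s ⟨hs.1, hs.2.trans ht.2⟩).trans (le_abs_self M)
    _ ≤ (2 * (m + 1) + (4 * m + 4) * |t₁ - t₀|) * |M| := by
        gcongr
        · linarith [(Nat.cast_nonneg m : (0 : ℝ) ≤ m)]
        · norm_num
    _ = (2 + 4 * |t₁ - t₀|) * |M| * (m + 1) := by ring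
    _ ≤ (2 + 4 * |t₁ - t₀|) * |M| * 2 ^ (m + 1) := by gcongr

end Forced

/-- The sequence `α` is the sequence of Taylor coefficients at `0` of a sectorial function. This is
admissibility without the limit at `-1`. -/
def HasSectorialExtension (α : ℕ+ → ℝ) : Prop :=
  ∃ G : ℂ → ℂ, IsSectorial G ∧
    ∀ᶠ z in 𝓝 (0 : ℂ), HasSum (fun k : ℕ => (α k.succPNat : ℂ) * z ^ k) (G z)

lemma IsAdmissible.hasSectorialExtension {α : ℕ+ → ℝ} (hα : IsAdmissible α) :
    HasSectorialExtension α := by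
  obtain ⟨G, hsum, han, -, hsector⟩ := hα
  exact ⟨G, ⟨han, hsector⟩, hsum⟩

section Solution

variable {G : ℂ → ℂ} {α : ℕ+ → ℝ} {w : ℝ → ℝ} {t₀ t : ℝ}

/-- The solution of the system driven by the path `w` whose generating function at time `t₀`
is `G`. -/
noncomputable def solution (G : ℂ → ℂ) (w : ℝ → ℝ) (t₀ : ℝ) : ℕ → ℝ → ℝ :=
  fun n t => homogeneous G n (t - t₀) + forced w t₀ n t

lemma IsSectorial.homogeneous_sub_eq (hG : IsSectorial G) {n : ℕ} (hn : 1 ≤ n) (ht : t₀ ≤ t) :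
    homogeneous G n (t - t₀) =
      homogeneous G n 0 + ∫ s in t₀..t, drift (homogeneous G) n (s - t₀) := by
  have hτ : ∀ τ ∈ Set.uIcc 0 (t - t₀), 0 ≤ τ := fun τ hτ =>
    (Set.uIcc_of_le (sub_nonneg.2 ht) ▸ hτ).1
  have hftc := intervalIntegral.integral_eq_sub_of_hasDerivAt
    (fun τ h => hG.hasDerivAt_homogeneous hn (hτ τ h))
    ((continuousOn_drift hG.continuousOn_homogeneous n).mono hτ).intervalIntegrable
  rw [intervalIntegral.integral_comp_sub_right (drift (homogeneous G) n), sub_self, hftc]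
  ring

lemma IsSectorial.solution_eq (hG : IsSectorial G) (hw : Continuous w) {n : ℕ} (hn : 1 ≤ n)
    (ht : t₀ ≤ t) :
    solution G w t₀ n t = solution G w t₀ n t₀ + (∫ s in t₀..t, drift (solution G w t₀) n s) +
      if n = 1 then w t - w t₀ else 0 := by
  have hshift : ContinuousOn (fun s => drift (homogeneous G) n (s - t₀)) (Set.uIcc t₀ t) :=
    (continuousOn_drift hG.continuousOn_homogeneous n).comp (by fun_prop) fun s hs =>
      sub_nonneg.2 (Set.uIcc_of_le ht ▸ hs).1
  have hforced := continuousOn_drift (fun j => (continuous_forced hw t₀ j).continuousOn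
    (s := Set.uIcc t₀ t)) n
  have hdrift : ∀ s, drift (solution G w t₀) n s =
      drift (homogeneous G) n (s - t₀) + drift (forced w t₀) n s := fun s =>
    congrFun (drift_add (fun j s => homogeneous G j (s - t₀)) (forced w t₀) n) s
  simp only [hdrift]
  rw [intervalIntegral.integral_add hshift.intervalIntegrable hforced.intervalIntegrable,
    solution, solution, hG.homogeneous_sub_eq hn ht, forced_eq_integral_drift hw t₀ hn, sub_self,
    forced_self]
  ring

theorem IsSectorial.isForcedSolution_solution (hG : IsSectorial G)
    (hα : ∀ᶠ z in 𝓝 (0 : ℂ), HasSum (fun k : ℕ => (α k.succPNat : ℂ) * z ^ k) (G z))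
    (hw : Continuous w) (t₀ : ℝ) : IsForcedSolution w t₀ α (solution G w t₀) where
  boundary t _ := add_zero 0
  initial n := by
    obtain ⟨k, rfl⟩ : ∃ k : ℕ, n = k.succPNat := ⟨n.natPred, n.succPNat_natPred.symm⟩
    rw [solution, sub_self, forced_self, add_zero]
    exact homogeneous_zero_right hα k
  continuous n := by
    refine ContinuousOn.add ?_ (continuous_forced hw t₀ n).continuousOn
    exact (hG.continuousOn_homogeneous n).comp (by fun_prop) fun s hs =>
      Set.mem_Ici.2 (sub_nonneg.2 hs)
  equation n hn t ht := hG.solution_eq hw hn ht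
  growth t₁ _ := by
    obtain ⟨C, K, hC, hK, hCK⟩ := hG.exists_abs_homogeneous_le (t₁ - t₀)
    obtain ⟨D, hD, hbound⟩ := exists_abs_forced_le hw t₀ t₁
    refine ⟨C + D, max K 2, fun n t ht => ?_⟩
    have hτ : t - t₀ ∈ Set.Icc 0 (t₁ - t₀) :=
      ⟨sub_nonneg.2 ht.1, sub_le_sub_right ht.2 t₀⟩
    calc |solution G w t₀ n t| ≤ |homogeneous G n (t - t₀)| + |forced w t₀ n t| := abs_add_le _ _
      _ ≤ C * K ^ n + D * 2 ^ n := add_le_add (hCK n _ hτ) (hbound n t ht)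
      _ ≤ C * max K 2 ^ n + D * max K 2 ^ n := by
        gcongr
        · exact le_max_left _ _
        · exact le_max_right _ _
      _ = (C + D) * max K 2 ^ n := by ring

lemma HasSectorialExtension.exists_isForcedSolution (hα : HasSectorialExtension α)
    (hw : Continuous w) (t₀ : ℝ) : ∃ a, IsForcedSolution w t₀ α a := by
  obtain ⟨G, hG, hsum⟩ := hα
  exact ⟨_, hG.isForcedSolution_solution hsum hw t₀⟩

end Solution

/-! ### Integrals along paths of linear growth -/

/-- The growth condition on a driving path under which its integrals over half-lines against
decaying kernels converge. -/
def HasLinearGrowth (w : ℝ → ℝ) : Prop := ∃ C : ℝ, ∀ s, |w s| ≤ C * (1 + |s|)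

lemma HasLinearGrowth.exists_abs_increment_le {w : ℝ → ℝ} (hw : HasLinearGrowth w) (t : ℝ) :
    ∃ D, 0 ≤ D ∧ ∀ u, 0 ≤ u → |w t - w (t - u)| ≤ D * Real.exp (u / 2) := by
  obtain ⟨C, hC⟩ := hw
  have hC0 : 0 ≤ C := by simpa using (abs_nonneg _).trans (hC 0)
  refine ⟨C * (1 + |t|) + C * (2 + |t|), by positivity, fun u hu => ?_⟩
  have hexp : 1 + u / 2 ≤ Real.exp (u / 2) := add_comm (u / 2) 1 ▸ Real.add_one_le_exp (u / 2)
  have hexp_one : 1 ≤ Real.exp (u / 2) := by linarith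
  have hsub : 1 + |t - u| ≤ (2 + |t|) * Real.exp (u / 2) := by
    have habs : |t - u| ≤ |t| + u := (abs_sub t u).trans_eq (by rw [abs_of_nonneg hu])
    nlinarith [mul_le_mul_of_nonneg_left hexp_one (abs_nonneg t)]
  calc |w t - w (t - u)| ≤ |w t| + |w (t - u)| := abs_sub _ _
    _ ≤ C * (1 + |t|) + C * (1 + |t - u|) := add_le_add (hC _) (hC _)
    _ ≤ C * (1 + |t|) * Real.exp (u / 2) + C * ((2 + |t|) * Real.exp (u / 2)) := by
        gcongr ?_ + C * ?_
        exact le_mul_of_one_le_right (by positivity) hexp_one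
    _ = (C * (1 + |t|) + C * (2 + |t|)) * Real.exp (u / 2) := by ring

lemma integrableOn_const_mul_exp_neg_half (B : ℝ) :
    IntegrableOn (fun u : ℝ => B * Real.exp (-(1 / 2) * u)) (Set.Ioi 0) :=
  (integrableOn_exp_mul_Ioi (by norm_num : -(1 / 2 : ℝ) < 0) 0).const_mul B

namespace IsDecayingKernel

variable {h V : ℝ → ℝ} {B D : ℝ}

lemma nonneg (hh : IsDecayingKernel h B) : 0 ≤ B := by
  simpa using (abs_nonneg _).trans (hh.abs_le 0 le_rfl)

lemma abs_mul_le {a v u : ℝ} (ha : |a| ≤ B * Real.exp (-u)) (hv : |v| ≤ D * Real.exp (u / 2)) :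
    |a * v| ≤ B * D * Real.exp (-(1 / 2) * u) := by
  rw [abs_mul]
  calc |a| * |v| ≤ (B * Real.exp (-u)) * (D * Real.exp (u / 2)) :=
        mul_le_mul ha hv (abs_nonneg _) ((abs_nonneg _).trans ha)
    _ = B * D * (Real.exp (-u) * Real.exp (u / 2)) := by ring
    _ = B * D * Real.exp (-(1 / 2) * u) := by rw [← Real.exp_add]; ring_nf

lemma tendsto_mul_atTop (hh : IsDecayingKernel h B)
    (hV : ∀ u, 0 ≤ u → |V u| ≤ D * Real.exp (u / 2)) :
    Tendsto (fun u => h u * V u) atTop (𝓝 0) := by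
  have hbound : Tendsto (fun u : ℝ => B * D * Real.exp (-(1 / 2) * u)) atTop (𝓝 0) := by
    simpa using (Real.tendsto_exp_atBot.comp
      (tendsto_id.const_mul_atTop_of_neg (by norm_num : -(1 / 2 : ℝ) < 0))).const_mul (B * D)
  refine squeeze_zero_norm' ?_ hbound
  filter_upwards [eventually_ge_atTop 0] with u hu using abs_mul_le (hh.abs_le u hu) (hV u hu)

lemma integrableOn_deriv_mul (hh : IsDecayingKernel h B) (hVc : Continuous V)
    (hV : ∀ u, 0 ≤ u → |V u| ≤ D * Real.exp (u / 2)) :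
    IntegrableOn (fun u => deriv h u * V u) (Set.Ioi 0) := by
  refine (integrableOn_const_mul_exp_neg_half (B * D)).mono'
    ((hh.contDiff.continuous_deriv le_rfl).mul hVc).aestronglyMeasurable ?_
  filter_upwards [ae_restrict_mem measurableSet_Ioi] with u hu
  exact abs_mul_le (hh.abs_deriv_le u (le_of_lt hu)) (hV u (le_of_lt hu))

end IsDecayingKernel

/-- The integral `∫ h (t - s) dw(s)` over `(-∞, t]` along a continuous path `w`, defined through
integration by parts. -/
noncomputable def pathIntegral (h w : ℝ → ℝ) (t : ℝ) : ℝ :=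
  -∫ u in Set.Ioi (0 : ℝ), deriv h u * (w t - w (t - u))

lemma tendsto_response {h w : ℝ → ℝ} {B : ℝ} (hh : IsDecayingKernel h B) (hw : Continuous w)
    (hgrowth : HasLinearGrowth w) (t : ℝ) :
    Tendsto (fun t₀ => response h w t₀ t) atBot (𝓝 (pathIntegral h w t)) := by
  obtain ⟨D, -, hV⟩ := hgrowth.exists_abs_increment_le t
  have helapsed : Tendsto (fun t₀ : ℝ => t - t₀) atBot atTop :=
    tendsto_atTop_add_const_left atBot t tendsto_neg_atBot_atTop
  have hboundary := (hh.tendsto_mul_atTop hV).comp helapsed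
  have hintegral := intervalIntegral_tendsto_integral_Ioi 0
    (hh.integrableOn_deriv_mul (by fun_prop) hV) helapsed
  rw [pathIntegral, ← zero_sub]
  refine (hboundary.sub hintegral).congr fun t₀ => ?_
  rw [response_eq_integral_increment hh.contDiff hw, Function.comp_apply, sub_sub_cancel]

section RiemannSum

variable {h w : ℝ → ℝ} {B t : ℝ} {M : ℕ}

/-- The Riemann sum over `(t - M, t]`, of mesh `1 / M`, for the integral `∫ h (t - s) dw(s)` over
`(-∞, t]`. -/
noncomputable def riemannSum (h w : ℝ → ℝ) (t : ℝ) (M : ℕ) : ℝ :=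
  ∑ i ∈ Finset.range (M * M), h (i / M) * (w (t - i / M) - w (t - (i + 1) / M))

lemma sum_range_mul_sub (a b : ℕ → ℝ) (N : ℕ) :
    ∑ i ∈ Finset.range N, a i * (b (i + 1) - b i) =
      a N * b N - a 0 * b 0 - ∑ i ∈ Finset.range N, (a (i + 1) - a i) * b (i + 1) := by
  induction N with
  | zero => simp
  | succ N ih => rw [Finset.sum_range_succ, Finset.sum_range_succ, ih]; ring

lemma ceil_mul_eq_of_mem_Ioc (hM : 0 < M) {i : ℕ} {u : ℝ}
    (hu : u ∈ Set.Ioc ((i : ℝ) / M) ((i + 1 : ℕ) / M)) : ⌈M * u⌉₊ = i + 1 := by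
  have hM' : (0 : ℝ) < M := Nat.cast_pos.2 hM
  rw [Nat.ceil_eq_iff (Nat.add_one_ne_zero i), Nat.add_sub_cancel, mul_comm]
  exact ⟨(div_lt_iff₀ hM').1 hu.1, (le_div_iff₀ hM').1 hu.2⟩

lemma deriv_mul_ceil_eqOn (h w : ℝ → ℝ) (t : ℝ) (hM : 0 < M) (i : ℕ) :
    Set.EqOn (fun u => deriv h u * (w t - w (t - ⌈M * u⌉₊ / M)))
      (fun u => deriv h u * (w t - w (t - (i + 1 : ℕ) / M)))
      (Set.uIoc ((i : ℝ) / M) ((i + 1 : ℕ) / M)) := by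
  intro u hu
  rw [Set.uIoc_of_le (by gcongr; exact i.le_succ)] at hu
  simp only [ceil_mul_eq_of_mem_Ioc hM hu]

lemma integral_deriv_mul_ceil (hh : ContDiff ℝ 1 h) (w : ℝ → ℝ) (t : ℝ) (hM : 0 < M) :
    ∫ u in (0)..M, deriv h u * (w t - w (t - ⌈M * u⌉₊ / M)) =
      ∑ i ∈ Finset.range (M * M), (h ((i + 1 : ℕ) / M) - h (i / M)) *
        (w t - w (t - (i + 1 : ℕ) / M)) := by
  have hh' := hh.continuous_deriv le_rfl
  have hpiece := deriv_mul_ceil_eqOn h w t hM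
  have hsum := intervalIntegral.sum_integral_adjacent_intervals (μ := volume) (n := M * M)
    (a := fun i : ℕ => (i : ℝ) / M) fun i _ =>
      IntervalIntegrable.congr (fun u hu => (hpiece i hu).symm)
        ((hh'.mul continuous_const).intervalIntegrable _ _)
  rw [Nat.cast_mul, mul_self_div_self, Nat.cast_zero, zero_div] at hsum
  rw [← hsum]
  refine Finset.sum_congr rfl fun i _ => ?_
  rw [intervalIntegral.integral_congr_ae (ae_of_all _ (hpiece i)),
    intervalIntegral.integral_mul_const, intervalIntegral.integral_deriv_eq_sub
      (fun u _ => (hh.differentiable one_ne_zero).differentiableAt) (hh'.intervalIntegrable _ _)]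

lemma riemannSum_eq_sub_integral (hh : ContDiff ℝ 1 h) (w : ℝ → ℝ) (t : ℝ) (hM : 0 < M) :
    riemannSum h w t M = h M * (w t - w (t - M)) -
      ∫ u in (0)..M, deriv h u * (w t - w (t - ⌈M * u⌉₊ / M)) := by
  have habel := sum_range_mul_sub (fun i => h (i / M)) (fun i => w t - w (t - i / M)) (M * M)
  simp only [Nat.cast_mul, mul_self_div_self, Nat.cast_zero, zero_div, sub_zero, sub_self,
    mul_zero] at habel
  rw [integral_deriv_mul_ceil hh w t hM, ← habel, riemannSum]
  refine Finset.sum_congr rfl fun i _ => ?_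
  push_cast
  ring

lemma abs_increment_ceil_le {V : ℝ → ℝ} {D u : ℝ} (hD : 0 ≤ D)
    (hV : ∀ u, 0 ≤ u → |V u| ≤ D * Real.exp (u / 2)) (hM : 0 < M) (hu : 0 ≤ u) :
    |V (⌈M * u⌉₊ / M)| ≤ D * Real.exp (1 / 2) * Real.exp (u / 2) := by
  have hM' : (1 : ℝ) ≤ M := Nat.one_le_cast.2 hM
  have hceil : (⌈M * u⌉₊ : ℝ) / M ≤ u + 1 := by
    rw [div_le_iff₀ (by positivity)]
    nlinarith [Nat.ceil_lt_add_one (by positivity : 0 ≤ M * u)]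
  refine (hV _ (by positivity)).trans ?_
  rw [mul_assoc, ← Real.exp_add]
  gcongr
  linarith

lemma IsDecayingKernel.abs_indicator_deriv_mul_ceil_le (hh : IsDecayingKernel h B) {V : ℝ → ℝ}
    {D u : ℝ} (hD : 0 ≤ D) (hV : ∀ u, 0 ≤ u → |V u| ≤ D * Real.exp (u / 2)) (M : ℕ) (hu : 0 < u) :
    |(Set.Iic (M : ℝ)).indicator (fun u => deriv h u * V (⌈M * u⌉₊ / M)) u| ≤
      B * (D * Real.exp (1 / 2)) * Real.exp (-(1 / 2) * u) := by
  by_cases huM : u ≤ M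
  · rw [Set.indicator_of_mem (Set.mem_Iic.2 huM)]
    exact abs_mul_le (hh.abs_deriv_le u hu.le)
      (abs_increment_ceil_le hD hV (Nat.cast_pos.1 (hu.trans_le huM)) hu.le)
  · have := hh.nonneg
    rw [Set.indicator_of_notMem (mt Set.mem_Iic.1 huM), abs_zero]
    positivity

lemma tendsto_ceil_mul_div {u : ℝ} (hu : 0 ≤ u) :
    Tendsto (fun M : ℕ => (⌈(M : ℝ) * u⌉₊ : ℝ) / M) atTop (𝓝 u) := by
  simpa [Function.comp_def, mul_comm] using
    (tendsto_nat_ceil_mul_div_atTop hu).comp (tendsto_natCast_atTop_atTop (R := ℝ))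

lemma tendsto_integral_deriv_mul_ceil (hh : IsDecayingKernel h B) (hw : Continuous w)
    (hgrowth : HasLinearGrowth w) (t : ℝ) :
    Tendsto (fun M : ℕ => ∫ u in (0)..M, deriv h u * (w t - w (t - ⌈M * u⌉₊ / M))) atTop
      (𝓝 (∫ u in Set.Ioi 0, deriv h u * (w t - w (t - u)))) := by
  have := (hh.contDiff.continuous_deriv le_rfl).measurable
  have := hw.measurable
  obtain ⟨D, hD, hV⟩ := hgrowth.exists_abs_increment_le t
  have hindicator : ∀ M : ℕ, ∫ u in (0)..M, deriv h u * (w t - w (t - ⌈M * u⌉₊ / M)) =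
      ∫ u in Set.Ioi 0, (Set.Iic (M : ℝ)).indicator
        (fun u => deriv h u * (w t - w (t - ⌈M * u⌉₊ / M))) u := fun M => by
    rw [intervalIntegral.integral_of_le (Nat.cast_nonneg M),
      setIntegral_indicator measurableSet_Iic, Set.Ioi_inter_Iic]
  simp only [hindicator]
  refine tendsto_integral_of_dominated_convergence
    (fun u => B * (D * Real.exp (1 / 2)) * Real.exp (-(1 / 2) * u)) (fun M => ?_)
    (integrableOn_const_mul_exp_neg_half _) (fun M => ?_) ?_
  · exact (Measurable.indicator (by fun_prop) measurableSet_Iic).aestronglyMeasurable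
  · filter_upwards [ae_restrict_mem measurableSet_Ioi] with u (hu : 0 < u)
    exact hh.abs_indicator_deriv_mul_ceil_le (V := fun u => w t - w (t - u)) hD hV M hu
  · filter_upwards [ae_restrict_mem measurableSet_Ioi] with u (hu : 0 < u)
    have hlim : Tendsto (fun M : ℕ => deriv h u * (w t - w (t - ⌈(M : ℝ) * u⌉₊ / M))) atTop
        (𝓝 (deriv h u * (w t - w (t - u)))) :=
      (((hw.tendsto _).comp ((tendsto_ceil_mul_div hu.le).const_sub t)).const_sub _).const_mul _
    refine hlim.congr' ?_
    filter_upwards [(tendsto_natCast_atTop_atTop (R := ℝ)).eventually_ge_atTop u] with M hM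
    rw [Set.indicator_of_mem (Set.mem_Iic.2 hM)]

theorem tendsto_riemannSum (hh : IsDecayingKernel h B) (hw : Continuous w)
    (hgrowth : HasLinearGrowth w) (t : ℝ) :
    Tendsto (fun M : ℕ => riemannSum h w t (M + 1)) atTop (𝓝 (pathIntegral h w t)) := by
  obtain ⟨D, -, hV⟩ := hgrowth.exists_abs_increment_le t
  have hboundary := (hh.tendsto_mul_atTop hV).comp (tendsto_natCast_atTop_atTop (R := ℝ))
  have hlim := hboundary.sub (tendsto_integral_deriv_mul_ceil hh hw hgrowth t)
  rw [zero_sub] at hlim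
  exact ((tendsto_add_atTop_iff_nat 1).2 hlim).congr fun M =>
    (riemannSum_eq_sub_integral hh.contDiff w t M.succ_pos).symm

end RiemannSum

/-! ### Two-sided Brownian motion -/

section Growth

variable {Ω : Type*} [MeasurableSpace Ω] {P : Measure Ω}

lemma identDistrib_comp_of_isPreBrownianReal {X Y : ℝ≥0 → Ω → ℝ} (hX : IsPreBrownianReal X P)
    (hY : IsPreBrownianReal Y P) (d : ℕ → ℝ≥0) :
    IdentDistrib (fun ω k => X (d k) ω) (fun ω k => Y (d k) ω) P P := by
  classical
  have := hX.isGaussianProcess.isProbabilityMeasure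
  rw [identDistrib_iff_forall_finset_identDistrib
    (X := fun k ω => X (d k) ω) (Y := fun k ω => Y (d k) ω)
    (aemeasurable_pi_lambda _ fun k => hX.aemeasurable _)
    (aemeasurable_pi_lambda _ fun k => hY.aemeasurable _)]
  intro I
  exact ((hX.hasLaw (I.image d)).identDistrib (hY.hasLaw (I.image d))).comp
    (u := fun (x : I.image d → ℝ) (i : I) => x ⟨d i, Finset.mem_image_of_mem d i.2⟩) (by fun_prop)

lemma measurableSet_exists_forall_abs_le_one (s : ℕ → ℝ≥0) :
    MeasurableSet {x : ℕ → ℝ | ∃ n : ℕ, ∀ k, s k ≤ 1 / (n + 1) → |x k| ≤ 1} := by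
  simp only [Set.ofPred_exists, Set.ofPred_forall]
  exact MeasurableSet.iUnion fun n => MeasurableSet.iInter fun k => MeasurableSet.iInter fun _ =>
    measurableSet_le (by fun_prop) measurable_const

lemma ae_exists_forall_abs_le_one_of_isBrownianReal {B : ℝ≥0 → Ω → ℝ}
    (hB : IsBrownianReal B P) :
    ∀ᵐ ω ∂P, ∃ n : ℕ, ∀ s : ℝ≥0, s ≤ 1 / (n + 1) → |B s ω| ≤ 1 := by
  filter_upwards [hB.tendsto_nhds_zero] with ω hω
  have hsmall : ∀ᶠ s in 𝓝 (0 : ℝ≥0), |B s ω| < 1 := by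
    simpa using hω.abs.eventually_lt_const (by simp)
  obtain ⟨ε, hε, hball⟩ := Metric.eventually_nhds_iff_ball.1 hsmall
  obtain ⟨n, hn⟩ := exists_nat_one_div_lt hε
  refine ⟨n, fun s hs => (hball s ?_).le⟩
  rw [Metric.mem_ball, NNReal.dist_eq, NNReal.coe_zero, sub_zero, NNReal.abs_eq]
  exact lt_of_le_of_lt (by exact_mod_cast hs) hn

-- Time inversion `t * B (1 / t)` turns boundedness near `0` into linear growth at infinity. It
-- preserves the law only, so the comparison has to be made on countably many times.
lemma ae_exists_forall_abs_comp_le_of_isBrownianReal {B : ℝ≥0 → Ω → ℝ}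
    (hB : IsBrownianReal B P) (d : ℕ → ℝ≥0) :
    ∀ᵐ ω ∂P, ∃ n : ℕ, ∀ k, (n : ℝ≥0) + 1 < d k → |B (d k) ω| ≤ d k := by
  have hinv := identDistrib_comp_of_isPreBrownianReal hB.toIsPreBrownianReal
    hB.toIsPreBrownianReal.inv fun k => 1 / d k
  have hmem := hinv.ae_mem_snd (measurableSet_exists_forall_abs_le_one fun k => 1 / d k) <| by
    filter_upwards [ae_exists_forall_abs_le_one_of_isBrownianReal hB] with ω ⟨n, hn⟩
    exact ⟨n, fun k => hn _⟩
  filter_upwards [hmem] with ω ⟨n, hn⟩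
  refine ⟨n, fun k hk => ?_⟩
  have hk0 : (0 : ℝ) < d k := lt_of_le_of_lt (by positivity) (NNReal.coe_lt_coe.2 hk)
  have hone := hn k (one_div_le_one_div_of_le (by positivity) hk.le)
  rw [one_div_one_div, abs_mul, NNReal.abs_eq] at hone
  push_cast at hone
  rwa [one_div, inv_mul_le_iff₀ hk0, mul_one] at hone

lemma abs_le_of_denseRange {b : ℝ≥0 → ℝ} (hb : Continuous b) {d : ℕ → ℝ≥0} (hd : DenseRange d)
    {r : ℝ≥0} (h : ∀ k, r < d k → |b (d k)| ≤ d k) {t : ℝ≥0} (ht : r < t) : |b t| ≤ t := by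
  have hclosed : IsClosed {t : ℝ≥0 | |b t| ≤ t} := isClosed_le (by fun_prop) (by fun_prop)
  refine closure_minimal ?_ hclosed (hd.open_subset_closure_inter (isOpen_Ioi (a := r)) ht)
  rintro _ ⟨hk, k, rfl⟩
  exact h k hk

lemma exists_abs_le_mul_one_add {b : ℝ≥0 → ℝ} (hb : Continuous b) {r : ℝ≥0}
    (h : ∀ t, r < t → |b t| ≤ t) : ∃ C : ℝ, ∀ t, |b t| ≤ C * (1 + t) := by
  obtain ⟨C, hC⟩ := (isCompact_Icc (a := (0 : ℝ≥0)) (b := r)).exists_bound_of_continuousOn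
    hb.continuousOn
  have hC0 : 0 ≤ C := (norm_nonneg _).trans (hC 0 ⟨le_rfl, zero_le⟩)
  refine ⟨C + 1, fun t => ?_⟩
  have ht : (0 : ℝ) ≤ t := t.2
  have hCt := mul_nonneg hC0 ht
  rcases le_or_gt t r with htr | htr
  · have hbt : |b t| ≤ C := hC t ⟨zero_le, htr⟩
    linarith
  · linarith [h t htr]

theorem ae_exists_abs_le_of_isBrownianReal {B : ℝ≥0 → Ω → ℝ}
    (hB : IsBrownianReal B P) :
    ∀ᵐ ω ∂P, ∃ C : ℝ, ∀ t, |B t ω| ≤ C * (1 + t) := by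
  filter_upwards [ae_exists_forall_abs_comp_le_of_isBrownianReal hB
    (TopologicalSpace.denseSeq ℝ≥0), hB.cont] with ω ⟨n, hn⟩ hcont
  exact exists_abs_le_mul_one_add hcont fun t ht =>
    abs_le_of_denseRange hcont (TopologicalSpace.denseRange_denseSeq ℝ≥0) hn ht

namespace IsTwoSidedBrownian

variable {W : ℝ → Ω → ℝ}

lemma ae_continuous (hW : IsTwoSidedBrownian W P) : ∀ᵐ ω ∂P, Continuous fun s => W s ω := by
  filter_upwards [hW.forward.cont, hW.backward.cont] with ω hforward hbackward
  have hIci : ContinuousOn (fun s => W s ω) (Set.Ici 0) :=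
    (hforward.comp continuous_real_toNNReal).continuousOn.congr fun s hs => by
      simp [Real.coe_toNNReal s hs]
  have hIic : ContinuousOn (fun s => W s ω) (Set.Iic 0) :=
    (hbackward.comp (continuous_real_toNNReal.comp continuous_neg)).continuousOn.congr
      fun s hs => by simp [Real.coe_toNNReal (-s) (neg_nonneg.2 hs)]
  rw [← continuousOn_univ, ← Set.Iic_union_Ici (a := (0 : ℝ))]
  exact hIic.union_of_isClosed hIci isClosed_Iic isClosed_Ici

lemma ae_hasLinearGrowth (hW : IsTwoSidedBrownian W P) :
    ∀ᵐ ω ∂P, HasLinearGrowth fun s => W s ω := by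
  filter_upwards [ae_exists_abs_le_of_isBrownianReal hW.forward,
    ae_exists_abs_le_of_isBrownianReal hW.backward] with ω ⟨C, hC⟩ ⟨C', hC'⟩
  refine ⟨max C C', fun s => ?_⟩
  rcases le_total 0 s with hs | hs
  · have hbound := hC s.toNNReal
    rw [Real.coe_toNNReal s hs] at hbound
    rw [abs_of_nonneg hs]
    exact hbound.trans (by gcongr; exact le_max_left _ _)
  · have hbound := hC' (-s).toNNReal
    rw [Real.coe_toNNReal (-s) (neg_nonneg.2 hs), neg_neg] at hbound
    rw [abs_of_nonpos hs]
    exact hbound.trans (mul_le_mul_of_nonneg_right (le_max_right _ _) (by linarith))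

end IsTwoSidedBrownian

end Growth

section Covariance

/-- The function `1_{(0, s]}` for `0 ≤ s` and `-1_{(s, 0]}` for `s ≤ 0`, which is the integrand
representing `W s - W 0` as a stochastic integral. -/
noncomputable def signedIndicator (s : ℝ) : ℝ → ℝ :=
  (Set.Ioc 0 s).indicator 1 - (Set.Ioc s 0).indicator 1

lemma signedIndicator_of_nonneg {s : ℝ} (hs : 0 ≤ s) :
    signedIndicator s = (Set.Ioc 0 s).indicator 1 := by
  rw [signedIndicator, Set.Ioc_eq_empty_of_le hs, Set.indicator_empty', sub_zero]

lemma signedIndicator_of_nonpos {s : ℝ} (hs : s ≤ 0) :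
    signedIndicator s = -(Set.Ioc s 0).indicator 1 := by
  rw [signedIndicator, Set.Ioc_eq_empty_of_le hs, Set.indicator_empty', zero_sub]

lemma indicator_Ioc_eq_signedIndicator_sub {l r : ℝ} (hlr : l ≤ r) (c x : ℝ) :
    (Set.Ioc l r).indicator (fun _ => c) x = c * (signedIndicator r x - signedIndicator l x) := by
  simp only [signedIndicator, Pi.sub_apply, Set.indicator, Set.mem_Ioc, Pi.one_apply]
  grind

lemma memLp_signedIndicator (s : ℝ) : MemLp (signedIndicator s) 2 volume :=
  (memLp_indicator_const 2 measurableSet_Ioc 1 (Or.inr (by simp))).sub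
    (memLp_indicator_const 2 measurableSet_Ioc 1 (Or.inr (by simp)))

lemma integral_indicator_Ioc_mul_indicator_Ioc (a b c d : ℝ) :
    ∫ x, (Set.Ioc a b).indicator (1 : ℝ → ℝ) x * (Set.Ioc c d).indicator (1 : ℝ → ℝ) x =
      max (min b d - max a c) 0 := by
  have hinter : ∀ x, (Set.Ioc a b).indicator (1 : ℝ → ℝ) x * (Set.Ioc c d).indicator 1 x =
      (Set.Ioc (max a c) (min b d)).indicator 1 x := fun x => by
    rw [← Set.Ioc_inter_Ioc, Set.inter_indicator_one, Pi.mul_apply]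
  simp only [hinter]
  rw [integral_indicator_one measurableSet_Ioc, Real.volume_real_Ioc]

lemma integral_signedIndicator_mul_of_nonneg {s t : ℝ} (hs : 0 ≤ s) (ht : 0 ≤ t) :
    ∫ x, signedIndicator s x * signedIndicator t x = min s t := by
  rw [signedIndicator_of_nonneg hs, signedIndicator_of_nonneg ht,
    integral_indicator_Ioc_mul_indicator_Ioc, max_self, sub_zero, max_eq_left (le_min hs ht)]

lemma integral_signedIndicator_mul_of_nonpos {s t : ℝ} (hs : s ≤ 0) (ht : t ≤ 0) :
    ∫ x, signedIndicator s x * signedIndicator t x = min (-s) (-t) := by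
  simp only [signedIndicator_of_nonpos hs, signedIndicator_of_nonpos ht, Pi.neg_apply, neg_mul_neg]
  rw [integral_indicator_Ioc_mul_indicator_Ioc, min_self, zero_sub, min_neg_neg,
    max_eq_left (neg_nonneg.2 (max_le hs ht))]

lemma integral_signedIndicator_mul_of_nonneg_of_nonpos {s t : ℝ} (hs : 0 ≤ s) (ht : t ≤ 0) :
    ∫ x, signedIndicator s x * signedIndicator t x = 0 := by
  simp only [signedIndicator_of_nonneg hs, signedIndicator_of_nonpos ht, Pi.neg_apply, mul_neg]
  rw [integral_neg, integral_indicator_Ioc_mul_indicator_Ioc, min_eq_right hs, max_eq_left ht,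
    sub_self, max_self, neg_zero]

variable {Ω : Type*} [MeasurableSpace Ω] {P : Measure Ω} {W : ℝ → Ω → ℝ}

namespace IsTwoSidedBrownian

lemma isGaussianProcess (hW : IsTwoSidedBrownian W P) : IsGaussianProcess W P where
  hasGaussianLaw I := by
    classical
    let p : ℝ → ℝ≥0 := fun s => s.toNNReal
    let q : ℝ → ℝ≥0 := fun s => (-s).toNNReal
    have hindep : IndepFun (fun ω => (I.image p).restrict fun t : ℝ≥0 => W (t : ℝ) ω)
        (fun ω => (I.image q).restrict fun t : ℝ≥0 => W (-(t : ℝ)) ω) P :=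
      hW.indep.comp (Finset.measurable_restrict _) (Finset.measurable_restrict _)
    have hjoint := hindep.hasGaussianLaw (hW.forward.isGaussianProcess.hasGaussianLaw (I.image p))
      (hW.backward.isGaussianProcess.hasGaussianLaw (I.image q))
    let L : ((I.image p → ℝ) × (I.image q → ℝ)) →L[ℝ] (I → ℝ) :=
      ContinuousLinearMap.pi fun i => if 0 ≤ (i : ℝ) then
        (ContinuousLinearMap.proj ⟨p i, Finset.mem_image_of_mem p i.2⟩).comp
          (ContinuousLinearMap.fst ℝ _ _)
      else (ContinuousLinearMap.proj ⟨q i, Finset.mem_image_of_mem q i.2⟩).comp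
          (ContinuousLinearMap.snd ℝ _ _)
    convert! hjoint.map L using 1
    ext ω i
    simp only [L, Function.comp_apply, ContinuousLinearMap.pi_apply, Finset.restrict]
    split_ifs with hi
    · simp [p, Real.coe_toNNReal _ hi]
    · simp [q, Real.coe_toNNReal _ (neg_nonneg.2 (not_le.1 hi).le)]

lemma memLp (hW : IsTwoSidedBrownian W P) (s : ℝ) : MemLp (W s) 2 P :=
  (hW.isGaussianProcess.hasGaussianLaw_eval s).memLp_two

lemma integral_eq_zero (hW : IsTwoSidedBrownian W P) (s : ℝ) : ∫ ω, W s ω ∂P = 0 := by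
  rcases le_total 0 s with hs | hs
  · simpa [Real.coe_toNNReal _ hs] using hW.forward.integral_eval s.toNNReal
  · simpa [Real.coe_toNNReal _ (neg_nonneg.2 hs)] using hW.backward.integral_eval (-s).toNNReal

lemma covariance_of_nonneg (hW : IsTwoSidedBrownian W P) {s t : ℝ} (hs : 0 ≤ s) (ht : 0 ≤ t) :
    cov[W s, W t; P] = min s t := by
  simpa only [Real.coe_toNNReal _ hs, Real.coe_toNNReal _ ht, NNReal.coe_min] using
    hW.forward.covariance_eval s.toNNReal t.toNNReal

lemma covariance_of_nonpos (hW : IsTwoSidedBrownian W P) {s t : ℝ} (hs : s ≤ 0) (ht : t ≤ 0) :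
    cov[W s, W t; P] = min (-s) (-t) := by
  simpa only [Real.coe_toNNReal _ (neg_nonneg.2 hs), Real.coe_toNNReal _ (neg_nonneg.2 ht),
    NNReal.coe_min, neg_neg] using hW.backward.covariance_eval (-s).toNNReal (-t).toNNReal

lemma covariance_of_nonneg_of_nonpos (hW : IsTwoSidedBrownian W P) {s t : ℝ} (hs : 0 ≤ s)
    (ht : t ≤ 0) : cov[W s, W t; P] = 0 := by
  have hindep : IndepFun (W s) (W t) P := by
    simpa [Function.comp_def, Real.coe_toNNReal _ hs, Real.coe_toNNReal _ (neg_nonneg.2 ht)] using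
      hW.indep.comp (measurable_pi_apply s.toNNReal) (measurable_pi_apply (-t).toNNReal)
  exact hindep.covariance_eq_zero (hW.memLp s) (hW.memLp t)

lemma covariance_eq_integral (hW : IsTwoSidedBrownian W P) (s t : ℝ) :
    cov[W s, W t; P] = ∫ x, signedIndicator s x * signedIndicator t x := by
  rcases le_total 0 s with hs | hs <;> rcases le_total 0 t with ht | ht
  · rw [hW.covariance_of_nonneg hs ht, integral_signedIndicator_mul_of_nonneg hs ht]
  · rw [hW.covariance_of_nonneg_of_nonpos hs ht,
      integral_signedIndicator_mul_of_nonneg_of_nonpos hs ht]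
  · simp only [mul_comm (signedIndicator s _)]
    rw [covariance_comm, hW.covariance_of_nonneg_of_nonpos ht hs,
      integral_signedIndicator_mul_of_nonneg_of_nonpos ht hs]
  · rw [hW.covariance_of_nonpos hs ht, integral_signedIndicator_mul_of_nonpos hs ht]

variable {ι : Type*} [Fintype ι]

lemma variance_sum_eq_integral (hW : IsTwoSidedBrownian W P) (a s : ι → ℝ) :
    Var[fun ω => ∑ i, a i * W (s i) ω; P] = ∫ x, (∑ i, a i * signedIndicator (s i) x) ^ 2 := by
  have := hW.isGaussianProcess.isProbabilityMeasure
  have hint : ∀ i j, Integrable fun x =>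
      a i * signedIndicator (s i) x * (a j * signedIndicator (s j) x) := fun i j =>
    ((memLp_signedIndicator _).const_mul _).integrable_mul ((memLp_signedIndicator _).const_mul _)
  simp only [sq, Finset.sum_mul_sum]
  rw [variance_fun_sum fun i => (hW.memLp _).const_mul _,
    integral_finsetSum _ fun i _ => integrable_finsetSum _ fun j _ => hint i j]
  refine Finset.sum_congr rfl fun i _ => ?_
  rw [integral_finsetSum _ fun j _ => hint i j]
  refine Finset.sum_congr rfl fun j _ => ?_
  simp only [mul_mul_mul_comm (a i) _ (a j)]
  rw [covariance_const_mul_left, covariance_const_mul_right, hW.covariance_eq_integral,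
    integral_const_mul, mul_assoc]

lemma hasLaw_sum (hW : IsTwoSidedBrownian W P) (a s : ι → ℝ) :
    HasLaw (fun ω => ∑ i, a i * W (s i) ω)
      (gaussianReal 0 (∫ x, (∑ i, a i * signedIndicator (s i) x) ^ 2).toNNReal) P := by
  have hgauss : HasGaussianLaw (fun ω => ∑ i, a i * W (s i) ω) P :=
    ((hW.isGaussianProcess.comp_right s).smul a).hasGaussianLaw_fun_sum
  have := hW.isGaussianProcess.isProbabilityMeasure
  have hmean : ∫ ω, ∑ i, a i * W (s i) ω ∂P = 0 := by
    rw [integral_finsetSum _ fun i _ => ((hW.memLp _).integrable one_le_two).const_mul _]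
    simp only [integral_const_mul, hW.integral_eq_zero, mul_zero, Finset.sum_const_zero]
  refine ⟨hgauss.aemeasurable, ?_⟩
  rw [hgauss.map_eq_gaussianReal, hmean, hW.variance_sum_eq_integral]

theorem hasLaw_integral (hW : IsTwoSidedBrownian W P) (g : StepFunction) :
    HasLaw (g.integral W) (gaussianReal 0 (∫ x, g.toFun x ^ 2).toNNReal) P := by
  have hsum : ∀ (X : ℝ → ℝ), ∑ i, g.c i * (X (g.r i) - X (g.l i)) =
      ∑ j, Sum.elim g.c (-g.c) j * X (Sum.elim g.r g.l j) := fun X => by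
    simp [Fintype.sum_sum_type, mul_sub, ← sub_eq_add_neg]
  have hintegral : g.integral W =
      fun ω => ∑ j, Sum.elim g.c (-g.c) j * W (Sum.elim g.r g.l j) ω :=
    funext fun ω => hsum fun s => W s ω
  have htoFun : ∀ x, g.toFun x =
      ∑ j, Sum.elim g.c (-g.c) j * signedIndicator (Sum.elim g.r g.l j) x := fun x => by
    rw [← hsum fun s => signedIndicator s x]
    exact Finset.sum_congr rfl fun i _ =>
      indicator_Ioc_eq_signedIndicator_sub (g.l_le_r i) (g.c i) x
  simp only [hintegral, htoFun]
  exact hW.hasLaw_sum _ _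

end IsTwoSidedBrownian

end Covariance

/-! ### Wiener integrals -/

section LTwo

variable {X Y : Type*} [MeasurableSpace X] [MeasurableSpace Y] {μ : Measure X} {ν : Measure Y}
  {f u v : X → ℝ} {g : Y → ℝ}

lemma toReal_eLpNorm_two_sq (hf : MemLp f 2 μ) :
    (eLpNorm f 2 μ).toReal ^ 2 = ∫ x, f x ^ 2 ∂μ := by
  have hnonneg : 0 ≤ ∫ x, f x ^ 2 ∂μ := integral_nonneg fun x => sq_nonneg _
  rw [hf.eLpNorm_eq_integral_rpow_norm two_ne_zero ENNReal.ofNat_ne_top]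
  simp only [ENNReal.toReal_ofNat, Real.rpow_ofNat, Real.norm_eq_abs, sq_abs]
  rw [ENNReal.toReal_ofReal (Real.rpow_nonneg hnonneg _), ← Real.rpow_natCast,
    ← Real.rpow_mul hnonneg]
  norm_num

lemma eLpNorm_two_eq_of_integral_sq_eq (hf : MemLp f 2 μ) (hg : MemLp g 2 ν)
    (h : ∫ x, f x ^ 2 ∂μ = ∫ y, g y ^ 2 ∂ν) : eLpNorm f 2 μ = eLpNorm g 2 ν := by
  rw [← ENNReal.toReal_eq_toReal_iff' hf.eLpNorm_ne_top hg.eLpNorm_ne_top,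
    ← sq_eq_sq₀ ENNReal.toReal_nonneg ENNReal.toReal_nonneg, toReal_eLpNorm_two_sq hf,
    toReal_eLpNorm_two_sq hg, h]

lemma tendsto_integral_sq {F : ℕ → X → ℝ} (hf : MemLp f 2 μ) (hF : ∀ k, MemLp (F k) 2 μ)
    (h : Tendsto (fun k => eLpNorm (F k - f) 2 μ) atTop (𝓝 0)) :
    Tendsto (fun k => ∫ x, F k x ^ 2 ∂μ) atTop (𝓝 (∫ x, f x ^ 2 ∂μ)) := by
  simpa only [Lp.norm_toLp, toReal_eLpNorm_two_sq (hF _), toReal_eLpNorm_two_sq hf] using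
    ((Lp.tendsto_Lp_iff_tendsto_eLpNorm'' F hF f hf).2 h).norm.pow 2

lemma integral_add_sq (hu : MemLp u 2 μ) (hv : MemLp v 2 μ) :
    ∫ x, (u x + v x) ^ 2 ∂μ =
      (∫ x, u x ^ 2 ∂μ) + 2 * (∫ x, u x * v x ∂μ) + ∫ x, v x ^ 2 ∂μ := by
  have huv : Integrable (fun x => 2 * (u x * v x)) μ := (hu.integrable_mul hv).const_mul 2
  simp only [add_sq, mul_assoc]
  rw [← integral_const_mul, ← integral_add hu.integrable_sq huv]
  exact integral_add (hu.integrable_sq.add huv) hv.integrable_sq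

lemma tendsto_eLpNorm_sum_const_mul_sub {κ : Type*} [Fintype κ] (a : κ → ℝ) {p : ℝ≥0∞}
    (hp : 1 ≤ p) {F : κ → X → ℝ} {G : κ → ℕ → X → ℝ} (hF : ∀ k, AEStronglyMeasurable (F k) μ)
    (hG : ∀ k j, AEStronglyMeasurable (G k j) μ)
    (h : ∀ k, Tendsto (fun j => eLpNorm (fun x => F k x - G k j x) p μ) atTop (𝓝 0)) :
    Tendsto (fun j => eLpNorm (fun x => ∑ k, a k * F k x - ∑ k, a k * G k j x) p μ)
      atTop (𝓝 0) := by
  have hle : ∀ j, eLpNorm (fun x => ∑ k, a k * F k x - ∑ k, a k * G k j x) p μ ≤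
      ∑ k, ‖a k‖ₑ * eLpNorm (fun x => F k x - G k j x) p μ := fun j => by
    have hsum : (fun x => ∑ k, a k * F k x - ∑ k, a k * G k j x) =
        ∑ k, a k • fun x => F k x - G k j x := by
      ext x
      simp [← Finset.sum_sub_distrib, mul_sub]
    simp only [hsum, ← eLpNorm_const_smul]
    exact eLpNorm_sum_le (fun k _ => ((hF k).sub (hG k j)).const_smul (a k)) hp
  refine tendsto_of_tendsto_of_tendsto_of_le_of_le tendsto_const_nhds ?_ (fun _ => zero_le) hle
  simpa using tendsto_finsetSum Finset.univ fun k _ =>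
    ENNReal.Tendsto.const_mul (h k) (Or.inr (enorm_ne_top (x := a k)))

end LTwo

section GaussianLaw

variable {Ω : Type*} [MeasurableSpace Ω] {P : Measure Ω} {X : Ω → ℝ} {v : ℝ≥0}

lemma memLp_two_of_hasLaw_gaussianReal (h : HasLaw X (gaussianReal 0 v) P) : MemLp X 2 P :=
  h.hasGaussianLaw.memLp_two

lemma integral_eq_zero_of_hasLaw_gaussianReal (h : HasLaw X (gaussianReal 0 v) P) :
    ∫ ω, X ω ∂P = 0 := by
  rw [h.integral_eq, integral_id_gaussianReal]

lemma integral_sq_of_hasLaw_gaussianReal (h : HasLaw X (gaussianReal 0 v) P) :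
    ∫ ω, X ω ^ 2 ∂P = v := by
  rw [← variance_of_integral_eq_zero h.aemeasurable (integral_eq_zero_of_hasLaw_gaussianReal h),
    h.variance_eq, variance_id_gaussianReal]

lemma hasLaw_gaussianReal_of_tendstoInMeasure {Y : ℕ → Ω → ℝ} {m : ℝ} {ms : ℕ → ℝ}
    {vs : ℕ → ℝ≥0} (hY : ∀ k, HasLaw (Y k) (gaussianReal (ms k) (vs k)) P)
    (hYX : TendstoInMeasure P Y atTop X) (hm : Tendsto ms atTop (𝓝 m))
    (hv : Tendsto vs atTop (𝓝 v)) : HasLaw X (gaussianReal m v) P := by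
  have := (hY 0).hasGaussianLaw.isProbabilityMeasure
  have hdist := hYX.tendstoInDistribution fun k => (hY k).aemeasurable
  refine ⟨hdist.aemeasurable_limit, ?_⟩
  have := Measure.isProbabilityMeasure_map (μ := P) hdist.aemeasurable_limit
  refine Measure.ext_of_charFun (funext fun t => ?_)
  refine tendsto_nhds_unique
    (ProbabilityMeasure.tendsto_iff_tendsto_charFun.1 hdist.tendsto t) ?_
  simp only [ProbabilityMeasure.coe_mk, (hY _).map_eq, charFun_gaussianReal]
  have hm' := (Complex.continuous_ofReal.tendsto m).comp hm
  have hv' := (Complex.continuous_ofReal.tendsto v).comp (NNReal.tendsto_coe.2 hv)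
  exact (((hm'.const_mul _).mul_const _).sub ((hv'.mul_const _).div_const _)).cexp

end GaussianLaw

namespace StepFunction

variable {κ : Type*} [Fintype κ]

/-- The linear combination `∑ k, a k * g k` of step functions, its steps being indexed by an
enumeration of the disjoint union of the steps of the `g k`. -/
noncomputable def linComb (a : κ → ℝ) (g : κ → StepFunction) : StepFunction where
  size := Fintype.card (Σ k, Fin (g k).size)
  c i := a ((Fintype.equivFin _).symm i).1 * (g _).c ((Fintype.equivFin _).symm i).2
  l i := (g _).l ((Fintype.equivFin (Σ k, Fin (g k).size)).symm i).2
  r i := (g _).r ((Fintype.equivFin (Σ k, Fin (g k).size)).symm i).2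
  l_le_r _ := (g _).l_le_r _

lemma toFun_linComb (a : κ → ℝ) (g : κ → StepFunction) (x : ℝ) :
    (linComb a g).toFun x = ∑ k, a k * (g k).toFun x := by
  refine ((Fintype.equivFin (Σ k, Fin (g k).size)).symm.sum_comp fun q =>
    (Set.Ioc ((g q.1).l q.2) ((g q.1).r q.2)).indicator
      (fun _ => a q.1 * (g q.1).c q.2) x).trans ?_
  simp only [Fintype.sum_sigma, toFun, Finset.mul_sum, Set.indicator_const_mul]

lemma integral_linComb (a : κ → ℝ) (g : κ → StepFunction) {Ω : Type*} (W : ℝ → Ω → ℝ) (ω : Ω) :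
    (linComb a g).integral W ω = ∑ k, a k * (g k).integral W ω := by
  refine ((Fintype.equivFin (Σ k, Fin (g k).size)).symm.sum_comp fun q =>
    a q.1 * (g q.1).c q.2 * (W ((g q.1).r q.2) ω - W ((g q.1).l q.2) ω)).trans ?_
  simp only [Fintype.sum_sigma, integral, Finset.mul_sum, mul_assoc]

lemma memLp_toFun (g : StepFunction) : MemLp g.toFun 2 volume :=
  memLp_finsetSum _ fun _ _ =>
    memLp_indicator_const 2 measurableSet_Ioc _ (Or.inr measure_Ioc_lt_top.ne)

end StepFunction

section WienerIntegral

variable {Ω : Type*} [MeasurableSpace Ω] {P : Measure Ω} {W : ℝ → Ω → ℝ} {f : ℝ → ℝ} {I : Ω → ℝ}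

namespace IsTwoSidedBrownian

lemma memLp_integral (hW : IsTwoSidedBrownian W P) (g : StepFunction) :
    MemLp (g.integral W) 2 P :=
  memLp_two_of_hasLaw_gaussianReal (hW.hasLaw_integral g)

lemma eLpNorm_integral (hW : IsTwoSidedBrownian W P) (g : StepFunction) :
    eLpNorm (g.integral W) 2 P = eLpNorm g.toFun 2 volume := by
  refine eLpNorm_two_eq_of_integral_sq_eq (hW.memLp_integral g) g.memLp_toFun ?_
  rw [integral_sq_of_hasLaw_gaussianReal (hW.hasLaw_integral g),
    Real.coe_toNNReal _ (integral_nonneg fun x => sq_nonneg _)]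

lemma eLpNorm_integral_sub (hW : IsTwoSidedBrownian W P) (g h : StepFunction) :
    eLpNorm (fun ω => g.integral W ω - h.integral W ω) 2 P =
      eLpNorm (fun x => g.toFun x - h.toFun x) 2 volume := by
  convert! hW.eLpNorm_integral (StepFunction.linComb ![1, -1] ![g, h]) using 2 <;> ext <;>
    simp [StepFunction.integral_linComb, StepFunction.toFun_linComb, sub_eq_add_neg]

lemma eLpNorm_sub_integral_le_of_ae_tendsto (hW : IsTwoSidedBrownian W P) (hf : MemLp f 2 volume)
    {g : ℕ → StepFunction}
    (hg : Tendsto (fun k => eLpNorm (fun x => f x - (g k).toFun x) 2 volume) atTop (𝓝 0))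
    (hI : ∀ᵐ ω ∂P, Tendsto (fun k => (g k).integral W ω) atTop (𝓝 (I ω))) (k : ℕ) :
    eLpNorm (fun ω => I ω - (g k).integral W ω) 2 P ≤
      eLpNorm (fun x => f x - (g k).toFun x) 2 volume := by
  have htriangle : ∀ j, eLpNorm (fun ω => (g j).integral W ω - (g k).integral W ω) 2 P ≤
      eLpNorm (fun x => f x - (g j).toFun x) 2 volume +
        eLpNorm (fun x => f x - (g k).toFun x) 2 volume := fun j => by
    rw [hW.eLpNorm_integral_sub, add_comm]
    refine le_of_eq_of_le (congrArg (eLpNorm · 2 volume) (funext fun x => ?_)) (eLpNorm_sub_le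
      (hf.sub (g k).memLp_toFun).aestronglyMeasurable
      (hf.sub (g j).memLp_toFun).aestronglyMeasurable one_le_two)
    simp
  have hlim := hg.add_const (eLpNorm (fun x => f x - (g k).toFun x) 2 volume)
  rw [zero_add] at hlim
  calc eLpNorm (fun ω => I ω - (g k).integral W ω) 2 P
      ≤ liminf (fun j => eLpNorm (fun ω => (g j).integral W ω - (g k).integral W ω) 2 P) atTop :=
        Lp.eLpNorm_lim_le_liminf_eLpNorm
          (fun j => ((hW.memLp_integral _).sub (hW.memLp_integral _)).aestronglyMeasurable) _
          (hI.mono fun ω hω => hω.sub_const _)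
    _ ≤ liminf (fun j => eLpNorm (fun x => f x - (g j).toFun x) 2 volume +
          eLpNorm (fun x => f x - (g k).toFun x) 2 volume) atTop :=
        liminf_le_liminf (Eventually.of_forall htriangle)
    _ = eLpNorm (fun x => f x - (g k).toFun x) 2 volume := hlim.liminf_eq

end IsTwoSidedBrownian

namespace IsWienerIntegral

theorem hasLaw (h : IsWienerIntegral W P f I) (hW : IsTwoSidedBrownian W P) :
    HasLaw I (gaussianReal 0 (∫ x, f x ^ 2).toNNReal) P := by
  obtain ⟨hf, hI, g, hg, hgI⟩ := h
  refine hasLaw_gaussianReal_of_tendstoInMeasure (fun k => hW.hasLaw_integral (g k))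
    (tendstoInMeasure_of_tendsto_eLpNorm (p := 2) two_ne_zero
      (fun k => (hW.memLp_integral (g k)).aestronglyMeasurable) hI.aestronglyMeasurable
      (hgI.congr fun k => eLpNorm_sub_comm I ((g k).integral W) 2 P))
    tendsto_const_nhds ?_
  exact (continuous_real_toNNReal.tendsto _).comp (tendsto_integral_sq hf
    (fun k => (g k).memLp_toFun) (hg.congr fun k => eLpNorm_sub_comm f (g k).toFun 2 volume))

theorem sum {κ : Type*} [Fintype κ] {f : κ → ℝ → ℝ} {I : κ → Ω → ℝ}
    (h : ∀ k, IsWienerIntegral W P (f k) (I k)) (hW : IsTwoSidedBrownian W P) (a : κ → ℝ) :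
    IsWienerIntegral W P (fun x => ∑ k, a k * f k x) (fun ω => ∑ k, a k * I k ω) := by
  choose hf hI g hg hgI using h
  refine ⟨memLp_finsetSum _ fun k _ => (hf k).const_mul _,
    memLp_finsetSum _ fun k _ => (hI k).const_mul _,
    fun j => StepFunction.linComb a fun k => g k j, ?_, ?_⟩
  · simp only [StepFunction.toFun_linComb]
    exact tendsto_eLpNorm_sum_const_mul_sub a one_le_two (fun k => (hf k).aestronglyMeasurable)
      (fun k j => (g k j).memLp_toFun.aestronglyMeasurable) hg
  · simp only [StepFunction.integral_linComb]
    exact tendsto_eLpNorm_sum_const_mul_sub a one_le_two (fun k => (hI k).aestronglyMeasurable)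
      (fun k j => (hW.memLp_integral (g k j)).aestronglyMeasurable) hgI

theorem of_ae_tendsto (hW : IsTwoSidedBrownian W P) (hf : MemLp f 2 volume)
    {g : ℕ → StepFunction}
    (hg : Tendsto (fun k => eLpNorm (fun x => f x - (g k).toFun x) 2 volume) atTop (𝓝 0))
    (hI : ∀ᵐ ω ∂P, Tendsto (fun k => (g k).integral W ω) atTop (𝓝 (I ω))) :
    IsWienerIntegral W P f I := by
  have hle := hW.eLpNorm_sub_integral_le_of_ae_tendsto hf hg hI
  have hImeas : AEStronglyMeasurable I P := aestronglyMeasurable_of_tendsto_ae atTop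
    (fun k => (hW.memLp_integral (g k)).aestronglyMeasurable) hI
  have hmem : MemLp (I - (g 0).integral W) 2 P :=
    ⟨hImeas.sub (hW.memLp_integral (g 0)).aestronglyMeasurable,
      (hle 0).trans_lt (hf.sub (g 0).memLp_toFun).eLpNorm_lt_top⟩
  refine ⟨hf, ?_, g, hg, tendsto_of_tendsto_of_tendsto_of_le_of_le tendsto_const_nhds hg
    (fun _ => zero_le) hle⟩
  simpa using hmem.add (hW.memLp_integral (g 0))

lemma integral_eq_zero (h : IsWienerIntegral W P f I) (hW : IsTwoSidedBrownian W P) :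
    ∫ ω, I ω ∂P = 0 :=
  integral_eq_zero_of_hasLaw_gaussianReal (h.hasLaw hW)

lemma integral_sq (h : IsWienerIntegral W P f I) (hW : IsTwoSidedBrownian W P) :
    ∫ ω, I ω ^ 2 ∂P = ∫ x, f x ^ 2 := by
  rw [integral_sq_of_hasLaw_gaussianReal (h.hasLaw hW),
    Real.coe_toNNReal _ (integral_nonneg fun x => sq_nonneg _)]

theorem integral_mul {f' : ℝ → ℝ} {I' : Ω → ℝ} (h : IsWienerIntegral W P f I)
    (h' : IsWienerIntegral W P f' I') (hW : IsTwoSidedBrownian W P) :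
    ∫ ω, I ω * I' ω ∂P = ∫ x, f x * f' x := by
  have hsum := (sum (f := ![f, f']) (I := ![I, I']) (Fin.forall_fin_two.2 ⟨h, h'⟩) hW
    ![1, 1]).integral_sq hW
  simp only [Fin.sum_univ_two, Matrix.cons_val_zero, Matrix.cons_val_one, one_mul] at hsum
  rw [integral_add_sq h.1 h'.1, integral_add_sq h.2.1 h'.2.1, h.integral_sq hW,
    h'.integral_sq hW] at hsum
  linarith

end IsWienerIntegral

end WienerIntegral

section Grid

variable {h : ℝ → ℝ} {B u : ℝ} {M : ℕ}

lemma mem_Ioc_grid_iff (hM : 0 < M) (i : ℕ) (s t : ℝ) :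
    s ∈ Set.Ioc (t - (i + 1) / M) (t - i / M) ↔ 0 ≤ t - s ∧ ⌊M * (t - s)⌋₊ = i := by
  have hM' : (0 : ℝ) < M := Nat.cast_pos.2 hM
  have hiff : s ∈ Set.Ioc (t - ((i : ℝ) + 1) / M) (t - i / M) ↔
      (i : ℝ) ≤ M * (t - s) ∧ M * (t - s) < i + 1 := by
    rw [Set.mem_Ioc, sub_lt_comm, lt_div_iff₀ hM', le_sub_comm, div_le_iff₀ hM', mul_comm, and_comm]
  refine hiff.trans ⟨fun hi => ?_, ?_⟩
  · have hnonneg : 0 ≤ (M : ℝ) * (t - s) := (Nat.cast_nonneg i).trans hi.1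
    exact ⟨nonneg_of_mul_nonneg_right hnonneg hM', (Nat.floor_eq_iff hnonneg).2 hi⟩
  · rintro ⟨hs, rfl⟩
    exact ⟨Nat.floor_le (mul_nonneg hM'.le hs), Nat.lt_floor_add_one _⟩

/-- The step function whose elementary integral is `riemannSum h w t M`. -/
noncomputable def gridStep (h : ℝ → ℝ) (t : ℝ) (M : ℕ) : StepFunction where
  size := M * M
  c i := h ((i : ℕ) / M)
  l i := t - ((i : ℕ) + 1) / M
  r i := t - (i : ℕ) / M
  l_le_r i := by gcongr; linarith

lemma integral_gridStep {Ω : Type*} (W : ℝ → Ω → ℝ) (h : ℝ → ℝ) (t : ℝ) (M : ℕ) (ω : Ω) :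
    (gridStep h t M).integral W ω = riemannSum h (fun s => W s ω) t M := by
  rw [riemannSum, Finset.sum_range]
  rfl

/-- The approximation of `h` on `[0, M)` by its values on the grid of mesh `1 / M`, cut off
after `M`; it is the profile, as a function of `t - s`, of `gridStep h t M`. -/
noncomputable def gridSample (h : ℝ → ℝ) (M : ℕ) (u : ℝ) : ℝ :=
  if ⌊M * u⌋₊ < M * M then h (⌊M * u⌋₊ / M) else 0

lemma toFun_gridStep (h : ℝ → ℝ) (t : ℝ) (hM : 0 < M) (s : ℝ) :
    (gridStep h t M).toFun s = (Set.Ici 0).indicator (gridSample h M) (t - s) := by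
  have hsum : (gridStep h t M).toFun s = ∑ i ∈ Finset.range (M * M),
      if 0 ≤ t - s ∧ ⌊M * (t - s)⌋₊ = i then h (i / M) else 0 := by
    rw [Finset.sum_range]
    refine Finset.sum_congr rfl fun i _ => ?_
    rw [Set.indicator_apply]
    exact if_congr (mem_Ioc_grid_iff hM i s t) rfl rfl
  rw [hsum, Set.indicator_apply]
  by_cases hs : 0 ≤ t - s
  · simp only [hs, true_and, Finset.sum_ite_eq, Finset.mem_range, Set.mem_Ici, if_true, gridSample]
  · simp only [hs, false_and, if_false, Finset.sum_const_zero, Set.mem_Ici]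

lemma memLp_indicator_exp_neg (B : ℝ) :
    MemLp ((Set.Ici (0 : ℝ)).indicator fun u => B * Real.exp (-u)) 2 volume := by
  rw [memLp_indicator_iff_restrict measurableSet_Ici, memLp_two_iff_integrable_sq (by fun_prop)]
  simp only [mul_pow, ← Real.exp_nat_mul, Nat.cast_ofNat, mul_neg, ← neg_mul]
  exact ((integrableOn_Ici_iff_integrableOn_Ioi).2
    (integrableOn_exp_mul_Ioi (neg_lt_zero.2 two_pos) 0)).const_mul _

namespace IsDecayingKernel

lemma memLp (hh : IsDecayingKernel h B) : MemLp ((Set.Ici 0).indicator h) 2 volume := by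
  refine (memLp_indicator_exp_neg B).mono'
    (hh.contDiff.continuous.measurable.indicator measurableSet_Ici).aestronglyMeasurable
    (ae_of_all _ fun u => ?_)
  rw [norm_indicator_eq_indicator_norm]
  exact Set.indicator_le_indicator' fun hu => hh.abs_le u hu

lemma abs_gridSample_le (hh : IsDecayingKernel h B) (hM : 0 < M) (u : ℝ) :
    |gridSample h M u| ≤ B * Real.exp 1 * Real.exp (-u) := by
  have hB := hh.nonneg
  rw [gridSample]
  split_ifs
  · have hfloor : u - 1 ≤ ⌊M * u⌋₊ / M := by
      have hM' : (1 : ℝ) ≤ M := Nat.one_le_cast.2 hM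
      rw [le_div_iff₀ (by linarith)]
      nlinarith [Nat.sub_one_lt_floor ((M : ℝ) * u)]
    calc |h (⌊M * u⌋₊ / M)| ≤ B * Real.exp (-(⌊M * u⌋₊ / M)) := hh.abs_le _ (by positivity)
      _ ≤ B * Real.exp (1 + -u) := by gcongr; linarith
      _ = B * Real.exp 1 * Real.exp (-u) := by rw [Real.exp_add, mul_assoc]
  · rw [abs_zero]
    positivity

lemma abs_sub_gridSample_le (hh : IsDecayingKernel h B) (hM : 0 < M) (u : ℝ) :
    |(Set.Ici 0).indicator h u - (Set.Ici 0).indicator (gridSample h M) u| ≤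
      (Set.Ici 0).indicator (fun u => (B + B * Real.exp 1) * Real.exp (-u)) u := by
  by_cases hu : u ∈ Set.Ici 0
  · simp only [Set.indicator_of_mem hu, add_mul]
    exact (abs_sub _ _).trans (add_le_add (hh.abs_le u hu) (hh.abs_gridSample_le hM u))
  · simp only [Set.indicator_of_notMem hu, sub_zero, abs_zero, le_refl]

end IsDecayingKernel

lemma tendsto_gridSample (hh : Continuous h) (hu : 0 ≤ u) :
    Tendsto (fun M => gridSample h M u) atTop (𝓝 (h u)) := by
  have hfloor : Tendsto (fun M : ℕ => (⌊(M : ℝ) * u⌋₊ : ℝ) / M) atTop (𝓝 u) := by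
    simpa only [Function.comp_def, mul_comm u] using
      (tendsto_nat_floor_mul_div_atTop hu).comp (tendsto_natCast_atTop_atTop (R := ℝ))
  refine ((hh.tendsto u).comp hfloor).congr' ?_
  filter_upwards [(tendsto_natCast_atTop_atTop (R := ℝ)).eventually_gt_atTop u] with M hM
  have hlt : ⌊(M : ℝ) * u⌋₊ < M * M := by
    have hM' : (0 : ℝ) < M := hu.trans_lt hM
    rw [Nat.floor_lt (by positivity)]
    push_cast
    gcongr
  rw [gridSample, if_pos hlt, Function.comp_apply]

lemma tendsto_eLpNorm_two_of_dominated {X : Type*} [MeasurableSpace X] {μ : Measure X}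
    {f b : X → ℝ} {g : ℕ → X → ℝ} (hf : MemLp f 2 μ) (hg : ∀ k, MemLp (g k) 2 μ)
    (hb : MemLp b 2 μ) (hle : ∀ k x, |f x - g k x| ≤ b x)
    (hlim : ∀ x, Tendsto (fun k => g k x) atTop (𝓝 (f x))) :
    Tendsto (fun k => eLpNorm (fun x => f x - g k x) 2 μ) atTop (𝓝 0) := by
  have hsub : ∀ k, MemLp (fun x => f x - g k x) 2 μ := fun k => hf.sub (hg k)
  have hint : Tendsto (fun k => ∫ x, (f x - g k x) ^ 2 ∂μ) atTop (𝓝 (∫ _, (0 : ℝ) ∂μ)) := by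
    refine tendsto_integral_of_dominated_convergence (fun x => b x ^ 2)
      (fun k => (hsub k).integrable_sq.aestronglyMeasurable) hb.integrable_sq
      (fun k => ae_of_all _ fun x => ?_) (ae_of_all _ fun x => ?_)
    · rw [Real.norm_eq_abs, abs_pow]
      exact pow_le_pow_left₀ (abs_nonneg _) (hle k x) 2
    · simpa using ((hlim x).const_sub (f x)).pow 2
  rw [← ENNReal.tendsto_toReal_iff (fun k => (hsub k).eLpNorm_ne_top) ENNReal.zero_ne_top]
  simpa only [integral_zero, ← toReal_eLpNorm_two_sq (hsub _), Real.sqrt_zero,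
    Real.sqrt_sq ENNReal.toReal_nonneg, ENNReal.toReal_zero] using hint.sqrt

lemma IsDecayingKernel.tendsto_eLpNorm_sub_gridStep (hh : IsDecayingKernel h B) (t : ℝ) :
    Tendsto (fun M => eLpNorm (fun s => (Set.Ici 0).indicator h (t - s) -
      (gridStep h t (M + 1)).toFun s) 2 volume) atTop (𝓝 0) := by
  have hreflect := Measure.measurePreserving_sub_left volume t
  refine tendsto_eLpNorm_two_of_dominated (hh.memLp.comp_measurePreserving hreflect)
    (fun M => StepFunction.memLp_toFun _)
    ((memLp_indicator_exp_neg (B + B * Real.exp 1)).comp_measurePreserving hreflect)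
    (fun M s => ?_) fun s => ?_
  · rw [toFun_gridStep h t M.succ_pos]
    exact hh.abs_sub_gridSample_le M.succ_pos (t - s)
  · simp only [toFun_gridStep h t (Nat.succ_pos _)]
    by_cases hs : t - s ∈ Set.Ici 0
    · simp only [Set.indicator_of_mem hs]
      exact (tendsto_gridSample hh.contDiff.continuous hs).comp (tendsto_add_atTop_nat 1)
    · simp only [Set.indicator_of_notMem hs, tendsto_const_nhds]

end Grid

theorem isWienerIntegral_pathIntegral {Ω : Type*} [MeasurableSpace Ω] {P : Measure Ω}
    {W : ℝ → Ω → ℝ} (hW : IsTwoSidedBrownian W P) {h : ℝ → ℝ} {B : ℝ}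
    (hh : IsDecayingKernel h B) (t : ℝ) :
    IsWienerIntegral W P (fun s => (Set.Ici 0).indicator h (t - s))
      (fun ω => pathIntegral h (fun s => W s ω) t) := by
  refine IsWienerIntegral.of_ae_tendsto hW
    (hh.memLp.comp_measurePreserving (Measure.measurePreserving_sub_left volume t))
    (hh.tendsto_eLpNorm_sub_gridStep t) ?_
  filter_upwards [hW.ae_continuous, hW.ae_hasLinearGrowth] with ω hcont hgrowth
  simp only [integral_gridStep]
  exact tendsto_riemannSum hh hcont hgrowth t

/-! ### The limiting process -/

section Kernel

lemma tendsto_tanh_atTop : Tendsto Real.tanh atTop (𝓝 1) := by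
  have htanh : Real.tanh = fun x => 1 - 2 / (Real.exp (2 * x) + 1) := funext fun x => by
    rw [Real.tanh_eq, Real.exp_neg, two_mul, Real.exp_add]
    have := Real.exp_pos x
    field_simp
    ring
  have hexp : Tendsto (fun x : ℝ => Real.exp (2 * x) + 1) atTop atTop :=
    tendsto_atTop_add_const_right _ _
      (Real.tendsto_exp_atTop.comp (tendsto_id.const_mul_atTop two_pos))
  rw [htanh]
  simpa using (hexp.const_div_atTop 2).const_sub 1

lemma green_nonneg (m : ℕ) {u : ℝ} (hu : 0 ≤ u) : 0 ≤ green m u := by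
  rw [green, Real.tanh_eq_sinh_div_cosh]
  have := Real.sinh_nonneg_iff.2 hu
  have := Real.cosh_pos u
  positivity

lemma green_mul_green (a b : ℕ) (u : ℝ) :
    green a u * green b u = Real.tanh u ^ (a + b) * (1 - Real.tanh u ^ 2) := by
  have hcosh := (Real.cosh_pos u).ne'
  have hsech : 1 - Real.tanh u ^ 2 = 1 / Real.cosh u ^ 2 := by
    rw [Real.tanh_eq_sinh_div_cosh]
    field_simp
    rw [Real.cosh_sq, add_sub_cancel_left]
  rw [green, green, hsech, pow_add]
  field_simp

lemma integral_green_mul_green (a b : ℕ) :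
    ∫ u in Set.Ioi 0, green a u * green b u = 1 / ((a : ℝ) + b + 1) := by
  have hderiv : ∀ u : ℝ, HasDerivAt (fun v => Real.tanh v ^ (a + b + 1) / ((a : ℝ) + b + 1))
      (green a u * green b u) u := fun u => by
    refine (((hasDerivAt_tanh u).fun_pow (a + b + 1)).div_const _).congr_deriv ?_
    rw [green_mul_green, Nat.add_sub_cancel]
    push_cast
    field_simp
  rw [integral_Ioi_of_hasDerivAt_of_nonneg' (fun u _ => hderiv u)
    (fun u hu => mul_nonneg (green_nonneg a (Set.mem_Ioi.1 hu).le)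
      (green_nonneg b (Set.mem_Ioi.1 hu).le))
    ((tendsto_tanh_atTop.pow _).div_const _)]
  simp

lemma kernel_eq (n : ℕ+) (t : ℝ) :
    kernel n t = fun s => (Set.Ici 0).indicator (green (n - 1)) (t - s) := by
  ext s
  simp [kernel, green, Set.indicator_apply]

lemma kernel_add (n : ℕ+) (t h : ℝ) : kernel n (t + h) = fun x => kernel n t (x - h) := by
  simp only [kernel_eq, sub_sub_eq_add_sub]

lemma integral_kernel_mul_kernel (n m : ℕ+) (t : ℝ) :
    ∫ s, kernel n t s * kernel m t s = 1 / ((n : ℝ) + (m : ℝ) - 1) := by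
  simp only [kernel_eq]
  rw [integral_sub_left_eq_self (fun u => (Set.Ici 0).indicator (green (n - 1)) u *
    (Set.Ici 0).indicator (green (m - 1)) u) volume t]
  simp only [← Set.indicator_mul]
  rw [integral_indicator measurableSet_Ici, integral_Ici_eq_integral_Ioi,
    integral_green_mul_green, Nat.cast_pred n.pos, Nat.cast_pred m.pos]
  ring

end Kernel

section JointLaw

variable {Ω κ : Type*} [MeasurableSpace Ω] {P : Measure Ω} {W : ℝ → Ω → ℝ}
  {f : κ → ℝ → ℝ} {I I' : κ → Ω → ℝ}

namespace IsWienerIntegral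

lemma aemeasurable_pi [Countable κ] (h : ∀ k, IsWienerIntegral W P (f k) (I k)) :
    AEMeasurable (fun ω k => I k ω) P :=
  aemeasurable_pi_lambda _ fun k => (h k).2.1.aemeasurable

lemma dual [Finite κ] (h : ∀ k, IsWienerIntegral W P (f k) (I k))
    (hW : IsTwoSidedBrownian W P) (L : StrongDual ℝ (κ → ℝ)) :
    IsWienerIntegral W P (fun x => L fun k => f k x) (fun ω => L fun k => I k ω) := by
  classical
  have := Fintype.ofFinite κ
  have hL : ∀ x : κ → ℝ, L x = ∑ k, L (Pi.single k 1) * x k := fun x => by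
    conv_lhs => rw [pi_eq_sum_univ' x, map_sum]
    exact Finset.sum_congr rfl fun k _ => by rw [map_smul, smul_eq_mul, mul_comm]
  simp only [hL fun k => f k _, hL fun k => I k _]
  exact sum h hW fun k => L (Pi.single k 1)

lemma map_dual [Finite κ] (h : ∀ k, IsWienerIntegral W P (f k) (I k))
    (hW : IsTwoSidedBrownian W P) (L : StrongDual ℝ (κ → ℝ)) :
    (P.map fun ω k => I k ω).map L = gaussianReal 0 (∫ x, L (fun k => f k x) ^ 2).toNNReal := by
  rw [AEMeasurable.map_map_of_aemeasurable (by fun_prop) (aemeasurable_pi h)]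
  exact ((dual h hW L).hasLaw hW).map_eq

theorem isGaussianProcess (h : ∀ k, IsWienerIntegral W P (f k) (I k))
    (hW : IsTwoSidedBrownian W P) : IsGaussianProcess I P :=
  ⟨fun J => ⟨isGaussian_of_map_eq_gaussianReal fun L =>
    ⟨0, _, map_dual (fun k : J => h k) hW L⟩⟩⟩

theorem identDistrib_of_translate [Finite κ] (s : ℝ)
    (h : ∀ k, IsWienerIntegral W P (fun x => f k (x - s)) (I k))
    (h' : ∀ k, IsWienerIntegral W P (f k) (I' k)) (hW : IsTwoSidedBrownian W P) :
    IdentDistrib (fun ω k => I k ω) (fun ω k => I' k ω) P P := by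
  have := Fintype.ofFinite κ
  have := hW.isGaussianProcess.isProbabilityMeasure
  refine ⟨aemeasurable_pi h, aemeasurable_pi h', Measure.ext_of_charFunDual ?_⟩
  ext L
  rw [charFunDual_eq_charFun_map_one, charFunDual_eq_charFun_map_one, map_dual h hW,
    map_dual h' hW, integral_sub_right_eq_self (fun x => L (fun k => f k x) ^ 2) s]

end IsWienerIntegral

end JointLaw

section LimitSolution

/-- The process `a**` of the theorem along the driving path `w`: the solution of the system started
at time `-∞`. -/
noncomputable def limitSolution (w : ℝ → ℝ) (n : ℕ+) : ℝ → ℝ := pathIntegral (green (n - 1)) w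

theorem HasSectorialExtension.tendsto_isForcedSolution {α : ℕ+ → ℝ} (hα : HasSectorialExtension α)
    {w : ℝ → ℝ} (hw : Continuous w) (hgrowth : HasLinearGrowth w) {a : ℝ → ℕ → ℝ → ℝ}
    (ha : ∀ T, IsForcedSolution w (-T) α (a T)) (n : ℕ+) (t : ℝ) :
    Tendsto (fun T => a T n t) atTop (𝓝 (limitSolution w n t)) := by
  obtain ⟨G, hG, hsum⟩ := hα
  obtain ⟨m, rfl⟩ : ∃ m : ℕ, n = m.succPNat := ⟨n.natPred, n.succPNat_natPred.symm⟩
  have helapsed : Tendsto (fun T : ℝ => t - -T) atTop atTop := by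
    simpa only [sub_neg_eq_add, id_eq] using tendsto_atTop_add_const_left atTop t tendsto_id
  have hlim := ((hG.tendsto_homogeneous (m + 1)).comp helapsed).add
    ((tendsto_response (isDecayingKernel_green m) hw hgrowth t).comp tendsto_neg_atTop_atBot)
  rw [zero_add] at hlim
  refine hlim.congr' ?_
  filter_upwards [eventually_ge_atTop (-t)] with T hT
  exact ((hG.isForcedSolution_solution hsum hw (-T)).unique (ha T) (m + 1) (by linarith)).symm

variable {Ω : Type*} [MeasurableSpace Ω] {P : Measure Ω} {W : ℝ → Ω → ℝ}

theorem isWienerIntegral_limitSolution (hW : IsTwoSidedBrownian W P) (n : ℕ+) (t : ℝ) :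
    IsWienerIntegral W P (kernel n t) (fun ω => limitSolution (fun s => W s ω) n t) := by
  rw [kernel_eq]
  exact isWienerIntegral_pathIntegral hW (isDecayingKernel_green _) t

end LimitSolution

end ShellModel

theorem mainTheorem8_general {Ω : Type*} [MeasurableSpace Ω] (P : Measure Ω)
    (W : ℝ → Ω → ℝ) (hW : ShellModel.IsTwoSidedBrownian W P) :
    (∀ᵐ ω ∂P, ∀ (T : ℝ) (α : ℕ+ → ℝ), ShellModel.HasSectorialExtension α →
      ∃ a : ℕ → ℝ → ℝ, ShellModel.IsForcedSolution (fun s => W s ω) (-T) α a ∧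
        ∀ b : ℕ → ℝ → ℝ, ShellModel.IsForcedSolution (fun s => W s ω) (-T) α b →
          ∀ n t, -T ≤ t → b n t = a n t) ∧
    ∃ A : ℕ+ → ℝ → Ω → ℝ,
      (∀ n t, ShellModel.IsWienerIntegral W P (ShellModel.kernel n t) (A n t)) ∧
      (∀ᵐ ω ∂P, ∀ α : ℕ+ → ℝ, ShellModel.HasSectorialExtension α →
        ∀ a : ℝ → ℕ → ℝ → ℝ,
          (∀ T : ℝ, ShellModel.IsForcedSolution (fun s => W s ω) (-T) α (a T)) →
            ∀ (n : ℕ+) (t : ℝ), Tendsto (fun T : ℝ => a T n t) atTop (𝓝 (A n t ω))) ∧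
      IsGaussianProcess (fun (p : ℕ+ × ℝ) ω => A p.1 p.2 ω) P ∧
      (∀ n t, ∫ ω, A n t ω ∂P = 0) ∧
      (∀ (h : ℝ) (J : Finset (ℕ+ × ℝ)),
        IdentDistrib (fun ω (p : J) => A p.1.1 (p.1.2 + h) ω)
          (fun ω (p : J) => A p.1.1 p.1.2 ω) P P) ∧
      (∀ (n m : ℕ+) (t : ℝ), ∫ ω, A n t ω * A m t ω ∂P = 1 / ((n : ℝ) + (m : ℝ) - 1)) := by
  have hA := ShellModel.isWienerIntegral_limitSolution hW
  refine ⟨?_, fun n t ω => ShellModel.limitSolution (fun s => W s ω) n t, hA, ?_, ?_, ?_, ?_, ?_⟩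
  · filter_upwards [hW.ae_continuous] with ω hcont T α hα
    obtain ⟨a, ha⟩ := hα.exists_isForcedSolution hcont (-T)
    exact ⟨a, ha, fun b hb n t ht => ha.unique hb n ht⟩
  · filter_upwards [hW.ae_continuous, hW.ae_hasLinearGrowth] with ω hcont hgrowth α hα a ha
    exact hα.tendsto_isForcedSolution hcont hgrowth ha
  · exact ShellModel.IsWienerIntegral.isGaussianProcess (fun p : ℕ+ × ℝ => hA p.1 p.2) hW
  · exact fun n t => (hA n t).integral_eq_zero hW
  · exact fun h J => ShellModel.IsWienerIntegral.identDistrib_of_translate h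
      (fun p : J => ShellModel.kernel_add p.1.1 p.1.2 h ▸ hA p.1.1 (p.1.2 + h))
      (fun p : J => hA p.1.1 p.1.2) hW
  · exact fun n m t => ((hA n t).integral_mul (hA m t) hW).trans
      (ShellModel.integral_kernel_mul_kernel n m t)

theorem mainTheorem8 {Ω : Type*} [MeasurableSpace Ω] (P : Measure Ω) [IsProbabilityMeasure P]
    (W : ℝ → Ω → ℝ) (hW : ShellModel.IsTwoSidedBrownian W P) :
    -- almost surely, the system started at any time `-T` from any admissible datum has a solution,
    -- and only one
    (∀ᵐ ω ∂P, ∀ (T : ℝ) (α : ℕ+ → ℝ), ShellModel.IsAdmissible α →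
      ∃ a : ℕ → ℝ → ℝ, ShellModel.IsForcedSolution (fun s => W s ω) (-T) α a ∧
        ∀ b : ℕ → ℝ → ℝ, ShellModel.IsForcedSolution (fun s => W s ω) (-T) α b →
          ∀ n t, -T ≤ t → b n t = a n t) ∧
    ∃ A : ℕ+ → ℝ → Ω → ℝ,
      -- `A n t` is the stochastic integral over `(-∞, t]` of `tanh^{n-1}(t-s) / cosh(t-s)`
      (∀ n t, ShellModel.IsWienerIntegral W P (ShellModel.kernel n t) (A n t)) ∧
      -- convergence as the starting time `-T` goes to `-∞`
      (∀ (n : ℕ+) (t : ℝ), ∀ᵐ ω ∂P, ∀ α : ℕ+ → ℝ, ShellModel.IsAdmissible α →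
        ∀ a : ℝ → ℕ → ℝ → ℝ,
          (∀ T : ℝ, ShellModel.IsForcedSolution (fun s => W s ω) (-T) α (a T)) →
            Tendsto (fun T : ℝ => a T n t) atTop (𝓝 (A n t ω))) ∧
      -- the limit is a Gaussian process, jointly in `n` and `t`, with mean zero
      IsGaussianProcess (fun (p : ℕ+ × ℝ) ω => A p.1 p.2 ω) P ∧
      (∀ n t, ∫ ω, A n t ω ∂P = 0) ∧
      -- it is stationary
      (∀ (h : ℝ) (J : Finset (ℕ+ × ℝ)),
        IdentDistrib (fun ω (p : J) => A p.1.1 (p.1.2 + h) ω)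
          (fun ω (p : J) => A p.1.1 p.1.2 ω) P P) ∧
      -- its covariance
      (∀ (n m : ℕ+) (t : ℝ), ∫ ω, A n t ω * A m t ω ∂P = 1 / ((n : ℝ) + (m : ℝ) - 1)) := by
  obtain ⟨hexists, A, hA, hlim, hlaw⟩ := mainTheorem8_general P W hW
  refine ⟨hexists.mono fun ω h T α hα => h T α hα.hasSectorialExtension, A, hA, fun n t => ?_, hlaw⟩
  exact hlim.mono fun ω h α hα a ha => h α hα.hasSectorialExtension a ha n t
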